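/- Let $G$ be a connected commutative algebraic group over $\mathbb{C}$, with identity element $e$, Lie algebra $\mathrm{Lie}(G)$ and exponential map $\exp:\mathrm{Lie}(G)\to G$. Let $S\subset G$ be a closed irreducible algebraic subvariety with $e\in S$, and let $\langle S\rangle$ denote the smallest closed algebraic subgroup of $G$ containing $S$. If $\mathfrak{h}\subset\mathrm{Lie}(G)$ is a Lie subalgebra such that $S\subset\exp(\mathfrak{h})$, then $$\dim\langle S\rangle\le\dim_{\mathbb{C}}\mathfrak{h}.$$ -/

import Mathlib

open CategoryTheory AlgebraicGeometry MonoidalCategory CartesianMonoidalCategory MonObj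

noncomputable section

namespace AlgGrp

/-- The base `Spec ℂ`. -/
abbrev SpecC : Scheme.{0} := Spec (CommRingCat.of ℂ)

lemma le_preimage_top (G : Over SpecC) (U : G.left.Opens) : U ≤ G.hom ⁻¹ᵁ ⊤ := by simp

/-- The ring of regular functions on an open subset of a complex scheme is a `ℂ`-algebra, through
the structure morphism. -/
instance sectionsAlgebra (G : Over SpecC) (U : G.left.Opens) : Algebra ℂ Γ(G.left, U) :=
  RingHom.toAlgebra
    ((Scheme.ΓSpecIso (CommRingCat.of ℂ)).inv ≫ G.hom.appLE ⊤ U (le_preimage_top G U)).hom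

/-! ### Complex points -/

section Points

/-- The set `G(ℂ)` of complex points of a complex scheme `G`. -/
def Points (G : Over SpecC) : Type := 𝟙_ (Over SpecC) ⟶ G

variable {G : Over SpecC}

/-- A complex point, seen as a morphism over `Spec ℂ`. -/
def Points.toHom (x : Points G) : 𝟙_ (Over SpecC) ⟶ G := x

/-- The morphism `Spec ℂ ⟶ G` underlying a complex point. -/
def Points.hom (x : Points G) : SpecC ⟶ G.left := x.toHom.left

/-- The (closed) point of the underlying topological space of `G` given by a complex point. -/
def Points.pt (x : Points G) : G.left := x.hom (IsLocalRing.closedPoint ℂ)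

/-- The Zariski topology on `G(ℂ)`. -/
instance : TopologicalSpace (Points G) := TopologicalSpace.induced Points.pt inferInstance

/-- The group structure on `G(ℂ)` when `G` is a group scheme. -/
instance [GrpObj G] : Group (Points G) := inferInstanceAs (Group (𝟙_ (Over SpecC) ⟶ G))

lemma Points.top_le_preimage {x : Points G} {U : G.left.Opens} (hx : x.pt ∈ U) :
    ⊤ ≤ x.hom ⁻¹ᵁ U := by
  intro y _
  have hy : y = IsLocalRing.closedPoint ℂ :=
    Subsingleton.elim (α := PrimeSpectrum ℂ) _ _
  subst hy
  exact hx

open Classical in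
/-- The value `f(x) ∈ ℂ` at the complex point `x` of a regular function `f` on the open set `U`
(with the convention `f(x) = 0` for `x ∉ U`). -/
def evalAt {U : G.left.Opens} (f : Γ(G.left, U)) (x : Points G) : ℂ :=
  if hx : x.pt ∈ U then
    (x.hom.appLE U ⊤ (Points.top_le_preimage hx) ≫
      (Scheme.ΓSpecIso (CommRingCat.of ℂ)).hom).hom f
  else 0

end Points

/-! ### The Lie algebra of left invariant derivations -/

/-- Families of `ℂ`-linear derivations `𝒪(U) → 𝒪(U)`, one for each open subset `U` of `G`
(without any compatibility). -/
def DerFamily (G : Over SpecC) : Type :=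
  ∀ U : G.left.Opens, Derivation ℂ Γ(G.left, U) Γ(G.left, U)

section DerFamily

variable {G : Over SpecC}

instance : AddCommGroup (DerFamily G) :=
  inferInstanceAs (AddCommGroup (∀ U : G.left.Opens, Derivation ℂ Γ(G.left, U) Γ(G.left, U)))

instance : Module ℂ (DerFamily G) :=
  inferInstanceAs (Module ℂ (∀ U : G.left.Opens, Derivation ℂ Γ(G.left, U) Γ(G.left, U)))

/-- The commutator bracket, taken on each open set. -/
instance : LieRing (DerFamily G) where
  bracket D E := fun U => ⁅D U, E U⁆
  add_lie D E F := funext fun U => add_lie (D U) (E U) (F U)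
  lie_add D E F := funext fun U => lie_add (D U) (E U) (F U)
  lie_self D := funext fun U => lie_self (D U)
  leibniz_lie D E F := funext fun U => leibniz_lie (D U) (E U) (F U)

instance : LieAlgebra ℂ (DerFamily G) where
  lie_smul c D E := funext fun U => lie_smul c (D U) (E U)

@[simp] lemma DerFamily.add_apply (D E : DerFamily G) (U : G.left.Opens) (f : Γ(G.left, U)) :
    (D + E) U f = D U f + E U f := rfl

@[simp] lemma DerFamily.zero_apply (U : G.left.Opens) (f : Γ(G.left, U)) :
    (0 : DerFamily G) U f = 0 := rfl

@[simp] lemma DerFamily.smul_apply (c : ℂ) (D : DerFamily G) (U : G.left.Opens)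
    (f : Γ(G.left, U)) : (c • D) U f = c • D U f := rfl

@[simp] lemma DerFamily.lie_apply (D E : DerFamily G) (U : G.left.Opens) (f : Γ(G.left, U)) :
    ⁅D, E⁆ U f = D U (E U f) - E U (D U f) :=
  Derivation.commutator_apply (D1 := D U) (D2 := E U) f

end DerFamily

/-- Left translation `x ↦ g x` by a complex point `g` of the group scheme `G`. -/
def leftTranslation {G : Over SpecC} [GrpObj G] (g : Points G) : G ⟶ G :=
  lift (toUnit G ≫ g.toHom) (𝟙 G) ≫ μ

lemma map_smul_appLE {G : Over SpecC} (t : G ⟶ G) (U V : G.left.Opens) (h : V ≤ t.left ⁻¹ᵁ U)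
    (c : ℂ) (f : Γ(G.left, U)) :
    (t.left.appLE U V h).hom (c • f) = c • (t.left.appLE U V h).hom f := by
  rw [Algebra.smul_def, Algebra.smul_def, map_mul]
  congr 1
  have key : G.hom.appLE ⊤ U (le_preimage_top G U) ≫ t.left.appLE U V h =
      G.hom.appLE ⊤ V (le_preimage_top G V) := by
    rw [Scheme.Hom.appLE_comp_appLE]
    simp only [Over.w]
  exact congr(($key).hom ((Scheme.ΓSpecIso (CommRingCat.of ℂ)).inv.hom c))

lemma map_smul_res {G : Over SpecC} {U V : G.left.Opens} (h : V ≤ U)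
    (c : ℂ) (f : Γ(G.left, U)) :
    (G.left.presheaf.map (homOfLE h).op).hom (c • f) =
      c • (G.left.presheaf.map (homOfLE h).op).hom f := by
  have key := map_smul_appLE (𝟙 G) U V h c f
  have e : (𝟙 G : G ⟶ G).left.appLE U V h = G.left.presheaf.map (homOfLE h).op := by
    simp [Scheme.Hom.appLE]
    try rfl
  rw [← e]
  exact key

/-- The Lie algebra `Lie(G)` of a complex algebraic group `G`: the left invariant algebraic vector
fields, that is, the `ℂ`-linear derivations `D : 𝒪_G → 𝒪_G` of the structure sheaf that commute
with the pullback of functions along all left translations, with the commutator bracket. -/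
def lieAlg (G : Over SpecC) [GrpObj G] : LieSubalgebra ℂ (DerFamily G) where
  carrier := {D |
    (∀ (U V : G.left.Opens) (h : V ≤ U) (f : Γ(G.left, U)),
      D V ((G.left.presheaf.map (homOfLE h).op).hom f) =
        (G.left.presheaf.map (homOfLE h).op).hom (D U f)) ∧
    (∀ (g : Points G) (U : G.left.Opens) (f : Γ(G.left, U)),
      D ((leftTranslation g).left ⁻¹ᵁ U) (((leftTranslation g).left.app U).hom f) =
        ((leftTranslation g).left.app U).hom (D U f))}
  zero_mem' := by
    refine ⟨fun U V h f => ?_, fun g U f => ?_⟩ <;> simp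
  add_mem' := by
    rintro D E ⟨h1, h2⟩ ⟨h3, h4⟩
    refine ⟨fun U V h f => ?_, fun g U f => ?_⟩
    · simp only [DerFamily.add_apply, h1, h3, map_add]
    · simp only [DerFamily.add_apply, h2, h4, map_add]
  smul_mem' := by
    rintro c D ⟨h1, h2⟩
    refine ⟨fun U V h f => ?_, fun g U f => ?_⟩
    · rw [DerFamily.smul_apply, DerFamily.smul_apply, h1, map_smul_res]
    · rw [DerFamily.smul_apply, DerFamily.smul_apply, h2]
      have := map_smul_appLE (leftTranslation g) U _ le_rfl c (D U f)
      rw [Scheme.Hom.appLE_eq_app] at this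
      exact this.symm
  lie_mem' := by
    rintro D E ⟨h1, h2⟩ ⟨h3, h4⟩
    refine ⟨fun U V h f => ?_, fun g U f => ?_⟩
    · simp only [DerFamily.lie_apply, h1, h3, map_sub]
    · simp only [DerFamily.lie_apply, h2, h4, map_sub]

/-! ### The exponential map -/

section Exp

variable {G : Over SpecC} [GrpObj G]

/-- `φ : ℂ → G(ℂ)` is the holomorphic one-parameter subgroup generated by the left invariant vector
field `D`: it is a group homomorphism and a holomorphic integral curve of `D`. In terms of
functions: for every open `U ⊆ G` the set `φ⁻¹(U)` is open in `ℂ`, and for every regular function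
`f` on `U`, the function `f ∘ φ` is holomorphic on `φ⁻¹(U)` with derivative `(D f) ∘ φ`. -/
structure IsOneParameterSubgroup (D : lieAlg G) (φ : ℂ → Points G) : Prop where
  map_add : ∀ s t : ℂ, φ (s + t) = φ s * φ t
  isOpen_preimage : ∀ U : G.left.Opens, IsOpen {t : ℂ | (φ t).pt ∈ U}
  hasDerivAt : ∀ (U : G.left.Opens) (f : Γ(G.left, U)) (t : ℂ), (φ t).pt ∈ U →
    HasDerivAt (fun s => evalAt f (φ s)) (evalAt (D.1 U f) (φ t)) t

open Classical in
/-- The exponential map `exp : Lie(G) → G(ℂ)` of a complex algebraic group: `exp D = φ 1`, where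
`φ` is the one-parameter subgroup generated by `D`. (For an algebraic group `φ` always exists and
is unique; the other branch is never used.) -/
def exp (D : lieAlg G) : Points G :=
  if h : ∃ φ : ℂ → Points G, IsOneParameterSubgroup D φ then h.choose 1 else 1

end Exp

/-! ### The algebraic subgroup generated by a set -/

section Span

variable {G : Over SpecC} [GrpObj G]

/-- `⟨S⟩`: the smallest Zariski closed subgroup of `G(ℂ)` that contains `S`. -/
def algSpan (S : Set (Points G)) : Subgroup (Points G) :=
  sInf {K : Subgroup (Points G) | IsClosed (K : Set (Points G)) ∧ S ⊆ K}

lemma isLeast_algSpan (S : Set (Points G)) :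
    IsLeast {K : Subgroup (Points G) | IsClosed (K : Set (Points G)) ∧ S ⊆ K} (algSpan S) := by
  refine ⟨⟨?_, ?_⟩, fun K hK => sInf_le hK⟩
  · rw [algSpan, Subgroup.coe_sInf]
    exact isClosed_biInter fun K hK => hK.1
  · intro x hx
    simp only [algSpan, SetLike.mem_coe, Subgroup.mem_sInf]
    exact fun K hK => hK.2 hx

end Span

end AlgGrp

end

/-! In the commutative group G, products of one-parameter subgroups are again one-parameter
subgroups, so `exp` maps 𝔥 into the image of a single holomorphic homomorphism E : ℂ^d → G(ℂ) with d
≤ dim 𝔥 (`exists_holomorphic_hom`). This image is a subgroup, possibly not Zariski closed.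

Cut S down to an affine neighbourhood of e, giving S₀, and put T = S₀S₀⁻¹. The positive powers of T
are irreducible, are images of affine schemes of finite type, and lie in E(ℂ^d). The key point is
that such a set Z has Zariski closure of dimension at most d (`length_le_of_subset_range`): r
functions algebraically independent on Z attain on Z all values off a hypersurface of ℂ^r, by
Chevalley's theorem; composed with E they give a holomorphic map from a subset of ℂ^d reaching all
these values, and comparing Hausdorff dimensions yields 2r ≤ 2d.

Hence the increasing closures of the powers of T become stationary. The stationary closure is a
closed subgroup (`exists_subgroup_eq_closure_pow`) containing S, so it contains ⟨S⟩, and dim ⟨S⟩ ≤ d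
≤ dim 𝔥. -/

/-! ### Commutative algebra: rational points, generic surjectivity, Noether normalization. -/

section Algebra

open MvPolynomial

variable {k : Type*} [Field k]

/-- A nonzero algebra of finite type over an algebraically closed field has a rational point. -/
lemma nonempty_algHom_of_finiteType [IsAlgClosed k] (B : Type*) [CommRing B] [Algebra k B]
    [Algebra.FiniteType k B] [Nontrivial B] : Nonempty (B →ₐ[k] k) := by
  obtain ⟨M, hM⟩ := Ideal.exists_maximal B
  let : Field (B ⧸ M) := Ideal.Quotient.field M
  have : Module.Finite k (B ⧸ M) := finite_of_finite_type_of_isJacobsonRing k (B ⧸ M)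
  exact ⟨(IsAlgClosed.lift (M := k) (R := k) (S := B ⧸ M)).comp (Ideal.Quotient.mkₐ k M)⟩

/-- **Generic surjectivity**: the points of an algebra of finite type attain all values of a family
of algebraically independent elements outside a hypersurface. -/
lemma exists_mvPolynomial_forall_exists_algHom [IsAlgClosed k] {n : ℕ} {B : Type*} [CommRing B]
    [Algebra k B] [Algebra.FiniteType k B] (b : Fin n → B)
    (hb : ∀ p : MvPolynomial (Fin n) k, aeval b p = 0 → p = 0) :
    ∃ q : MvPolynomial (Fin n) k, q ≠ 0 ∧
      ∀ c : Fin n → k, eval c q ≠ 0 → ∃ χ : B →ₐ[k] k, ∀ i, χ (b i) = c i := by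
  set f : MvPolynomial (Fin n) k →+* B := (aeval b : MvPolynomial (Fin n) k →ₐ[k] B).toRingHom
  have hinj : Function.Injective f := (injective_iff_map_eq_zero f).2 hb
  have hft : f.FiniteType := by
    refine RingHom.FiniteType.of_comp_finiteType (f := algebraMap k _) ?_
    have : f.comp (algebraMap k _) = algebraMap k B := by
      ext x; simp [f]
    rw [this, RingHom.finiteType_algebraMap]
    infer_instance
  have hcons := PrimeSpectrum.isConstructible_range_comap
    ((RingHom.FinitePresentation.of_finiteType).1 hft)
  obtain ⟨T, hT⟩ := PrimeSpectrum.exists_constructibleSetData_iff.mpr hcons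
  -- The generic point is in the constructible image: minimal primes lift along an injective ring
  -- map.
  obtain ⟨P, hP⟩ : ∃ P : PrimeSpectrum B, PrimeSpectrum.comap f P = ⊥ := by
    have h0 : (⊥ : Ideal (MvPolynomial (Fin n) k)) ∈ minimalPrimes _ := by
      rw [IsDomain.minimalPrimes_eq_singleton_bot]; rfl
    obtain ⟨P, hP, h⟩ := Ideal.exists_comap_eq_of_mem_minimalPrimes_of_injective hinj _ h0
    exact ⟨⟨P, hP⟩, PrimeSpectrum.ext h⟩
  have hmem : (⊥ : PrimeSpectrum (MvPolynomial (Fin n) k)) ∈ T.toSet := by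
    rw [hT]; exact ⟨P, hP⟩
  simp only [PrimeSpectrum.ConstructibleSetData.toSet, Set.mem_iUnion] at hmem
  obtain ⟨Z, hZ, hmem⟩ := hmem
  simp only [PrimeSpectrum.BasicConstructibleSetData.toSet, Set.mem_sdiff,
    PrimeSpectrum.mem_zeroLocus, Set.singleton_subset_iff, SetLike.mem_coe] at hmem
  -- A basic piece V(g₁, …) \ V(f) containing the generic point has all gᵢ = 0, so it is the full
  -- basic open set of f. Hence q = f.
  refine ⟨Z.f, fun h => hmem.2 (by rw [h]; exact Ideal.zero_mem _), fun c hc => ?_⟩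
  have hcp : (RingHom.ker (eval c)).IsPrime := RingHom.ker_isPrime _
  have hmc : (⟨RingHom.ker (eval c), hcp⟩ : PrimeSpectrum (MvPolynomial (Fin n) k)) ∈ T.toSet := by
    simp only [PrimeSpectrum.ConstructibleSetData.toSet, Set.mem_iUnion]
    refine ⟨Z, hZ, ?_⟩
    simp only [PrimeSpectrum.BasicConstructibleSetData.toSet, Set.mem_sdiff,
      PrimeSpectrum.mem_zeroLocus, Set.singleton_subset_iff, SetLike.mem_coe, RingHom.mem_ker]
    refine ⟨fun x hx => ?_, hc⟩
    have : x = 0 := hmem.1 hx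
    simp [this]
  rw [hT] at hmc
  obtain ⟨Q, hQ⟩ := hmc
  -- Q lies over the maximal ideal of the point c, so any rational point of B/Q sends each `b i` to
  -- `c i`.
  have : Algebra.FiniteType k (B ⧸ Q.asIdeal) :=
    Algebra.FiniteType.of_surjective (Ideal.Quotient.mkₐ k Q.asIdeal)
      (Ideal.Quotient.mkₐ_surjective k Q.asIdeal)
  obtain ⟨χ⟩ := nonempty_algHom_of_finiteType (k := k) (B ⧸ Q.asIdeal)
  refine ⟨χ.comp (Ideal.Quotient.mkₐ k Q.asIdeal), fun i => ?_⟩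
  have h1 : (X i - C (c i) : MvPolynomial (Fin n) k) ∈ (PrimeSpectrum.comap f Q).asIdeal := by
    rw [hQ]; simp
  have h2 : b i - algebraMap k B (c i) ∈ Q.asIdeal := by
    simpa [f] using h1
  have h3 : Ideal.Quotient.mkₐ k Q.asIdeal (b i - algebraMap k B (c i)) = 0 :=
    Ideal.Quotient.eq_zero_iff_mem.2 h2
  have h4 := congrArg χ h3
  rw [map_sub, map_sub, map_zero, AlgHom.commutes, AlgHom.commutes, sub_eq_zero] at h4
  exact h4

/-- Incomparability: along an integral map, strictly nested primes have strictly nested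
contractions. -/
lemma ringKrullDim_le_of_isIntegral {A B : Type*} [CommRing A] [CommRing B] (f : A →+* B)
    (hf : f.IsIntegral) : ringKrullDim B ≤ ringKrullDim A := by
  let := f.toAlgebra
  have : Algebra.IsIntegral A B := ⟨hf⟩
  refine Order.krullDim_le_of_strictMono (PrimeSpectrum.comap f) fun P Q hPQ => ?_
  obtain ⟨x, hxQ, hxP⟩ := SetLike.exists_of_lt (show P.asIdeal < Q.asIdeal from hPQ)
  exact Ideal.comap_lt_comap_of_integral_mem_sdiff (I := P.asIdeal) (J := Q.asIdeal) hPQ.le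
    ⟨hxQ, hxP⟩ (hf x)

/-- In an algebra of finite type, a chain of `n + 1` primes above `I` yields `n` elements which are
algebraically independent modulo `I`. -/
lemma exists_algebraicIndependent_of_strictAnti {A : Type*} [CommRing A]
    [Algebra k A] [Algebra.FiniteType k A] (I : Ideal A) {n : ℕ} (P : Fin (n + 1) → Ideal A)
    (hP : ∀ i, (P i).IsPrime) (hIP : ∀ i, I ≤ P i) (hanti : StrictAnti P) :
    ∃ r, n ≤ r ∧ ∃ y : Fin r → A, ∀ p : MvPolynomial (Fin r) k, aeval y p ∈ I → p = 0 := by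
  have : Nontrivial (A ⧸ I) := Ideal.Quotient.nontrivial_iff.2
    fun h => (hP 0).ne_top (top_le_iff.1 (h ▸ hIP 0))
  have : Algebra.FiniteType k (A ⧸ I) :=
    Algebra.FiniteType.of_surjective (Ideal.Quotient.mkₐ k I) (Ideal.Quotient.mkₐ_surjective k I)
  -- Noether normalization: A/I is finite over a polynomial ring in r variables, so its dimension is
  -- at most r. The elements y lift the variables.
  obtain ⟨r, g, hg, hfin⟩ := exists_finite_inj_algHom_of_fg k (A ⧸ I)
  have hn : (n : WithBot ℕ∞) ≤ ringKrullDim (A ⧸ I) := by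
    rw [ringKrullDim_quotient]
    let c : LTSeries (PrimeSpectrum.zeroLocus (I : Set A)) :=
      { length := n
        toFun := fun i => ⟨⟨P i.rev, hP _⟩, hIP _⟩
        step := fun i => hanti (by simp [Fin.rev_lt_rev]) }
    exact Order.LTSeries.length_le_krullDim c
  have hr : ringKrullDim (A ⧸ I) ≤ r := by
    refine (ringKrullDim_le_of_isIntegral g.toRingHom hfin.to_isIntegral).trans ?_
    rw [MvPolynomial.ringKrullDim_of_isNoetherianRing, ringKrullDim_eq_zero_of_field]
    simp
  choose y hy using fun i => Ideal.Quotient.mk_surjective (g (X i))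
  refine ⟨r, by exact_mod_cast hn.trans hr, y, fun p hp => ?_⟩
  refine (injective_iff_map_eq_zero g).1 hg p ?_
  have h1 : (Ideal.Quotient.mkₐ k I).comp (aeval y) = g := by
    ext i; simp [hy]
  rw [← h1]
  exact Ideal.Quotient.eq_zero_iff_mem.2 hp

end Algebra

/-! ### Hausdorff dimension of holomorphic images. -/

section Analysis

open MvPolynomial

/-- A holomorphic map from an open subset of `ℂ ^ d` which attains all values outside a
hypersurface of `ℂ ^ r` can only exist if `r ≤ d`. -/
lemma le_of_analyticAt_of_subset_image {d r : ℕ} (F : (Fin d → ℂ) → (Fin r → ℂ))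
    (Ω : Set (Fin d → ℂ)) (hF : ∀ x ∈ Ω, AnalyticAt ℂ F x) (q : MvPolynomial (Fin r) ℂ)
    (hq : q ≠ 0) (hsub : {c | eval c q ≠ 0} ⊆ F '' Ω) : r ≤ d := by
  -- Analytic maps are locally Lipschitz, hence do not raise Hausdorff dimension.
  have h1 : dimH (F '' Ω) ≤ dimH Ω := by
    refine dimH_image_le_of_locally_lipschitzOn fun x hx => ?_
    obtain ⟨K, s, hs, hK⟩ := ((hF x hx).contDiffAt (n := 1)).exists_lipschitzOnWith
    exact ⟨K, s, mem_nhdsWithin_of_mem_nhds hs, hK⟩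
  have h2 : dimH Ω ≤ (Module.finrank ℝ (Fin d → ℂ) : ENNReal) :=
    (dimH_mono (Set.subset_univ _)).trans_eq (Real.dimH_univ_eq_finrank _)
  have h3 : (Module.finrank ℝ (Fin r → ℂ) : ENNReal) = dimH {c : Fin r → ℂ | eval c q ≠ 0} := by
    -- The complement of the hypersurface is open, and nonempty because a nonzero polynomial over ℂ
    -- is not identically zero as a function.
    refine (Real.dimH_of_nonempty_interior ?_).symm
    have : IsOpen {c : Fin r → ℂ | eval c q ≠ 0} :=
      isOpen_ne.preimage (MvPolynomial.continuous_eval q)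
    rw [this.interior_eq]
    by_contra hne
    refine hq (MvPolynomial.funext fun c => ?_)
    by_contra hc
    exact hne ⟨c, by simpa using hc⟩
  have h4 := h3.trans_le ((dimH_mono hsub).trans (h1.trans h2))
  have hfr : ∀ m : ℕ, Module.finrank ℝ (Fin m → ℂ) = m * 2 := fun m => by
    rw [Module.finrank_pi_fintype]; simp
  rw [hfr, hfr] at h4
  have : r * 2 ≤ d * 2 := by exact_mod_cast h4
  omega

end Analysis

/-! ### Irreducible sets, and groups with separately continuous multiplication. -/

lemma subset_closure_inter_of_isIrreducible {X : Type*} [TopologicalSpace X] {S U : Set X}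
    (hS : IsIrreducible S) (hU : IsOpen U) (h : (S ∩ U).Nonempty) : S ⊆ closure (S ∩ U) := by
  intro x hx
  refine mem_closure_iff.2 fun V hV hxV => ?_
  obtain ⟨z, hz, hzV, hzU⟩ := hS.2 _ _ hV hU ⟨x, hx, hxV⟩ h
  exact ⟨z, hzV, hz, hzU⟩

lemma isIrreducible_inter_of_isOpen {X : Type*} [TopologicalSpace X] {S U : Set X}
    (hS : IsIrreducible S) (hU : IsOpen U) (h : (S ∩ U).Nonempty) : IsIrreducible (S ∩ U) :=
  isIrreducible_iff_closure.1 (by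
    rw [(closure_mono Set.inter_subset_left).antisymm
      (closure_minimal (subset_closure_inter_of_isIrreducible hS hU h) isClosed_closure)]
    exact hS.closure)

section SeparatelyContinuous

open Pointwise Topology

variable {M : Type*} [Group M] [TopologicalSpace M] [SeparatelyContinuousMul M]

/-- The Zariski topology on G(ℂ) makes multiplication continuous only in each variable. So the
factors are treated in turn: first a common right factor c is found for both open sets, then a
common left factor d. -/
lemma IsIrreducible.mul {A B : Set M} (hA : IsIrreducible A) (hB : IsIrreducible B) :
    IsIrreducible (A * B) := by
  refine ⟨hA.1.mul hB.1, ?_⟩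
  rintro u v hu hv ⟨_, ⟨a, ha, b, hb, rfl⟩, hab⟩ ⟨_, ⟨a', ha', b', hb', rfl⟩, hab'⟩
  obtain ⟨c, hc, hc1, hc2⟩ := hB.2 _ _ (hu.preimage (continuous_const_mul a))
    (hv.preimage (continuous_const_mul a')) ⟨b, hb, hab⟩ ⟨b', hb', hab'⟩
  obtain ⟨d, hd, hd1, hd2⟩ := hA.2 _ _ (hu.preimage (continuous_mul_const c))
    (hv.preimage (continuous_mul_const c)) ⟨a, ha, hc1⟩ ⟨a', ha', hc2⟩
  exact ⟨d * c, Set.mul_mem_mul hd hc, hd1, hd2⟩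

lemma IsIrreducible.pow_succ {T : Set M} (hT : IsIrreducible T) (n : ℕ) :
    IsIrreducible (T ^ (n + 1)) := by
  induction n with
  | zero => simpa using hT
  | succ n ih =>
    rw [_root_.pow_succ]
    exact ih.mul hT

/-- Joint continuity not being available, the closure is taken in one variable and then in the
other. -/
lemma mul_mem_of_isClosed {A B C : Set M} (hC : IsClosed C) (h : A * B ⊆ C) {a b : M}
    (ha : a ∈ closure A) (hb : b ∈ closure B) : a * b ∈ C := by
  have h1 : ∀ a ∈ A, ∀ b ∈ closure B, a * b ∈ C := fun a ha b hb =>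
    closure_minimal (s := B) (t := (a * ·) ⁻¹' C) (fun b hb => h (Set.mul_mem_mul ha hb))
      (hC.preimage (continuous_const_mul a)) hb
  exact closure_minimal (s := A) (t := (· * b) ⁻¹' C) (fun a ha => h1 a ha b hb)
    (hC.preimage (continuous_mul_const b)) ha

/-- If the closures of the powers of a symmetric set `T` are stationary, they form a subgroup. -/
lemma exists_subgroup_eq_closure_pow [ContinuousInv M] {T : Set M} (h1 : (1 : M) ∈ T)
    (hinv : T⁻¹ = T) (m : ℕ) (hm : closure (T ^ m) = closure (T ^ (m + 1))) :
    ∃ K : Subgroup M, (K : Set M) = closure (T ^ m) := by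
  have hT : ∀ k, closure (T ^ (m + k)) ⊆ closure (T ^ m) := by
    intro k
    induction k with
    | zero => rfl
    | succ k ih =>
      refine closure_minimal ?_ isClosed_closure
      rw [← add_assoc, pow_succ]
      rintro _ ⟨a, ha, b, hb, rfl⟩
      refine mul_mem_of_isClosed (A := T ^ m) (B := T) isClosed_closure ?_
        (ih (subset_closure ha)) (subset_closure hb)
      rw [← pow_succ, hm]
      exact subset_closure
  refine ⟨{ carrier := closure (T ^ m), mul_mem' := ?_, one_mem' := ?_, inv_mem' := ?_ }, rfl⟩
  · intro a b ha hb
    refine mul_mem_of_isClosed isClosed_closure ?_ ha hb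
    rw [← pow_add]
    exact subset_closure.trans (hT m)
  · exact subset_closure (by simpa using Set.pow_mem_pow h1 (n := m))
  · intro a ha
    have : (closure (T ^ m))⁻¹ ⊆ closure (T ^ m) := by
      rw [inv_closure, ← inv_pow, hinv]
    exact this (Set.inv_mem_inv.2 ha)

end SeparatelyContinuous

noncomputable section

namespace AlgGrp

/-! ### Complex points and values of regular functions. -/

section Points

variable {G H : Over SpecC}

lemma Points.hom_comp (x : Points G) : x.hom ≫ G.hom = 𝟙 SpecC := Over.w x.toHom

lemma evalAt_of_mem {U : G.left.Opens} (f : Γ(G.left, U)) {x : Points G} (hx : x.pt ∈ U) :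
    evalAt f x = (x.hom.appLE U ⊤ (Points.top_le_preimage hx) ≫
      (Scheme.ΓSpecIso (CommRingCat.of ℂ)).hom).hom f := dif_pos hx

lemma evalAt_of_notMem {U : G.left.Opens} (f : Γ(G.left, U)) {x : Points G} (hx : x.pt ∉ U) :
    evalAt f x = 0 := dif_neg hx

lemma evalAt_algebraMap {U : G.left.Opens} {x : Points G} (hx : x.pt ∈ U) (c : ℂ) :
    evalAt (algebraMap ℂ Γ(G.left, U) c) x = c := by
  rw [evalAt_of_mem _ hx]
  have key : ((Scheme.ΓSpecIso (CommRingCat.of ℂ)).inv ≫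
      G.hom.appLE ⊤ U (le_preimage_top G U)) ≫ x.hom.appLE U ⊤ (Points.top_le_preimage hx) ≫
      (Scheme.ΓSpecIso (CommRingCat.of ℂ)).hom = 𝟙 _ := by
    have : ∀ (g : SpecC ⟶ SpecC) (hg : g = 𝟙 _) (e), g.appLE ⊤ ⊤ e = 𝟙 _ := by
      rintro _ rfl e
      simp only [Scheme.Hom.appLE, Scheme.Hom.id_app]
      exact SpecC.presheaf.map_id _
    rw [Category.assoc, Scheme.Hom.appLE_comp_appLE_assoc, this _ x.hom_comp, Category.id_comp,
      Iso.inv_hom_id]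
  exact congr(($key).hom c)

/-- Evaluation at a complex point of `U`, as a homomorphism of algebras. -/
def evalHom (U : G.left.Opens) (x : Points G) (hx : x.pt ∈ U) : Γ(G.left, U) →ₐ[ℂ] ℂ where
  toRingHom := (x.hom.appLE U ⊤ (Points.top_le_preimage hx) ≫
      (Scheme.ΓSpecIso (CommRingCat.of ℂ)).hom).hom
  commutes' c := by
    have := evalAt_algebraMap hx c
    rw [evalAt_of_mem _ hx] at this
    exact this

lemma evalHom_apply {U : G.left.Opens} {x : Points G} (hx : x.pt ∈ U) (f : Γ(G.left, U)) :
    evalHom U x hx f = evalAt f x := (evalAt_of_mem f hx).symm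

/-- The map induced on complex points by a morphism. -/
def Points.map (t : G ⟶ H) (x : Points G) : Points H := x.toHom ≫ t

lemma Points.map_pt (t : G ⟶ H) (x : Points G) : (x.map t).pt = t.left x.pt := rfl

lemma evalAt_map (t : G ⟶ H) (x : Points G) {U : H.left.Opens} (f : Γ(H.left, U)) :
    evalAt f (x.map t) = evalAt ((t.left.app U).hom f) x := by
  by_cases hx : x.pt ∈ t.left ⁻¹ᵁ U
  · have hx' : (x.map t).pt ∈ U := hx
    rw [evalAt_of_mem _ hx, evalAt_of_mem _ hx']
    have key : (x.map t).hom.appLE U ⊤ (Points.top_le_preimage hx') =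
        t.left.app U ≫ x.hom.appLE _ ⊤ (Points.top_le_preimage hx) :=
      Scheme.Hom.comp_appLE _ _ _ _ _
    rw [key]; rfl
  · rw [evalAt_of_notMem _ hx, evalAt_of_notMem _ (by exact hx)]

lemma evalAt_res {U V : G.left.Opens} (h : V ≤ U) (f : Γ(G.left, U)) {x : Points G}
    (hx : x.pt ∈ V) :
    evalAt ((G.left.presheaf.map (homOfLE h).op).hom f) x = evalAt f x := by
  rw [evalAt_of_mem _ hx, evalAt_of_mem _ (h hx)]
  have := Scheme.Hom.map_appLE x.hom (Points.top_le_preimage hx) (homOfLE h).op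
  rw [← this]; rfl

lemma evalAt_ne_zero_iff {U : G.left.Opens} (f : Γ(G.left, U)) (x : Points G) :
    evalAt f x ≠ 0 ↔ x.pt ∈ G.left.basicOpen f := by
  by_cases hx : x.pt ∈ U
  · rw [evalAt_of_mem _ hx]
    set g := (x.hom.appLE U ⊤ (Points.top_le_preimage hx)).hom f with hg
    have hb : SpecC.basicOpen g = ⊤ ⊓ x.hom ⁻¹ᵁ G.left.basicOpen f :=
      Scheme.basicOpen_appLE _ _ _ _ _
    have hpt : x.pt ∈ G.left.basicOpen f ↔ IsLocalRing.closedPoint ℂ ∈ SpecC.basicOpen g := by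
      rw [hb, top_inf_eq]; rfl
    rw [hpt]
    change (Scheme.ΓSpecIso (CommRingCat.of ℂ)).hom.hom g ≠ 0 ↔ _
    constructor
    · intro h
      have hu : IsUnit g := by
        have := (IsUnit.mk0 _ h).map (Scheme.ΓSpecIso (CommRingCat.of ℂ)).inv.hom
        rwa [← CommRingCat.comp_apply, Iso.hom_inv_id] at this
      rw [Scheme.basicOpen_of_isUnit _ hu]
      trivial
    · intro h h0
      have h1 : g = 0 := by
        have := congrArg (Scheme.ΓSpecIso (CommRingCat.of ℂ)).inv.hom h0
        rwa [map_zero, ← CommRingCat.comp_apply, Iso.hom_inv_id] at this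
      rw [h1, Scheme.basicOpen_zero] at h
      exact h
  · rw [evalAt_of_notMem _ hx]
    simp only [ne_eq, not_true_eq_false, false_iff]
    exact fun h => hx (G.left.basicOpen_le f h)

lemma pt_injective [LocallyOfFiniteType G.hom] : Function.Injective (Points.pt (G := G)) := by
  intro x y hxy
  refine Over.OverMorphism.ext ?_
  exact ext_of_apply_closedPoint_eq G.hom x.hom_comp y.hom_comp hxy

/-- Basic open sets are a basis of U and are detected by nonvanishing of values, so the two points
are topologically inseparable; a scheme is a T₀ space. -/
lemma Points.ext_of_evalAt [LocallyOfFiniteType G.hom] {U : G.left.Opens} (hU : IsAffineOpen U)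
    {x y : Points G} (hx : x.pt ∈ U) (hy : y.pt ∈ U)
    (h : ∀ f : Γ(G.left, U), evalAt f x = evalAt f y) : x = y := by
  refine pt_injective (Inseparable.eq (inseparable_iff_forall_isOpen.2 fun V hV => ?_))
  have main : ∀ {x y : Points G}, x.pt ∈ U →
      (∀ f : Γ(G.left, U), evalAt f x = evalAt f y) → x.pt ∈ V → y.pt ∈ V := by
    intro x y hx h hxV
    obtain ⟨f, hf, hxf⟩ := hU.exists_basicOpen_le (V := ⟨V, hV⟩) ⟨x.pt, hxV⟩ hx
    exact hf ((evalAt_ne_zero_iff f y).1 (h f ▸ (evalAt_ne_zero_iff f x).2 hxf))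
  exact ⟨main hx h, main hy fun f => (h f).symm⟩

lemma appLE_top_ΓSpecIso {R T : CommRingCat} (f : R ⟶ T) (e : ⊤ ≤ Spec.map f ⁻¹ᵁ ⊤) :
    (Spec.map f).appLE ⊤ ⊤ e ≫ (Scheme.ΓSpecIso T).hom = (Scheme.ΓSpecIso R).hom ≫ f := by
  rw [← Scheme.ΓSpecIso_naturality, Scheme.Hom.appTop, Scheme.Hom.app_eq_appLE]
  rfl

lemma appLE_fromSpec_ΓSpecIso {X : Scheme} {U : X.Opens} (hU : IsAffineOpen U) {T : CommRingCat}
    (f : Γ(X, U) ⟶ T) (e : ⊤ ≤ (Spec.map f ≫ hU.fromSpec) ⁻¹ᵁ U) :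
    (Spec.map f ≫ hU.fromSpec).appLE U ⊤ e ≫ (Scheme.ΓSpecIso T).hom = f := by
  have e' : ⊤ ≤ Spec.map f ⁻¹ᵁ (hU.fromSpec ⁻¹ᵁ U) := e
  have h : (Spec.map f ≫ hU.fromSpec).appLE U ⊤ e =
      hU.fromSpec.app U ≫ (Spec.map f).appLE _ ⊤ e' := Scheme.Hom.comp_appLE _ _ _ _ _
  rw [h, hU.fromSpec_app_self, Category.assoc, Category.assoc,
    Scheme.Hom.map_appLE_assoc, Iso.inv_comp_eq]
  exact appLE_top_ΓSpecIso _ _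

lemma SpecMap_fromSpec_hom {U : G.left.Opens} (hU : IsAffineOpen U)
    (χ : Γ(G.left, U) →ₐ[ℂ] ℂ) :
    (Spec.map (CommRingCat.ofHom χ.toRingHom) ≫ hU.fromSpec) ≫ G.hom = 𝟙 _ := by
  have h1 := IsAffineOpen.SpecMap_appLE_fromSpec G.hom (isAffineOpen_top SpecC) hU
    (le_preimage_top G U)
  rw [Category.assoc, ← h1, IsAffineOpen.fromSpec_top, ← Spec.map_comp_assoc,
    Scheme.isoSpec_Spec_inv, ← Spec.map_comp]
  have h2 : (Scheme.ΓSpecIso (CommRingCat.of ℂ)).inv ≫ G.hom.appLE ⊤ U (le_preimage_top G U) ≫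
      CommRingCat.ofHom χ.toRingHom = 𝟙 _ := by
    ext c
    exact χ.commutes c
  rw [h2, Spec.map_id]

/-- The complex point of an affine open set given by a homomorphism of algebras. -/
def pointOfAlgHom {U : G.left.Opens} (hU : IsAffineOpen U) (χ : Γ(G.left, U) →ₐ[ℂ] ℂ) :
    Points G :=
  Over.homMk (U := 𝟙_ (Over SpecC)) (V := G)
    (Spec.map (CommRingCat.ofHom χ.toRingHom) ≫ hU.fromSpec) (SpecMap_fromSpec_hom hU χ)

lemma pointOfAlgHom_pt_mem {U : G.left.Opens} (hU : IsAffineOpen U) (χ : Γ(G.left, U) →ₐ[ℂ] ℂ) :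
    (pointOfAlgHom hU χ).pt ∈ U := by
  have : (pointOfAlgHom hU χ).pt = hU.fromSpec (Spec.map (CommRingCat.ofHom χ.toRingHom)
    (IsLocalRing.closedPoint ℂ)) := rfl
  rw [this, ← SetLike.mem_coe, ← hU.range_fromSpec]
  exact ⟨_, rfl⟩

lemma evalAt_pointOfAlgHom {U : G.left.Opens} (hU : IsAffineOpen U)
    (χ : Γ(G.left, U) →ₐ[ℂ] ℂ) (f : Γ(G.left, U)) :
    evalAt f (pointOfAlgHom hU χ) = χ f := by
  have hx := pointOfAlgHom_pt_mem hU χ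
  rw [evalAt_of_mem _ hx]
  have key : (pointOfAlgHom hU χ).hom.appLE U ⊤ (Points.top_le_preimage hx) ≫
      (Scheme.ΓSpecIso (CommRingCat.of ℂ)).hom = CommRingCat.ofHom χ.toRingHom :=
    appLE_fromSpec_ΓSpecIso hU _ _
  rw [key]; rfl

/-- On complex points, a morphism induces a Zariski continuous map. -/
lemma Points.continuous_map (t : G ⟶ H) : Continuous (Points.map t) :=
  continuous_induced_rng.2 (t.left.continuous.comp continuous_induced_dom)

lemma Points.isOpen_setOf_pt_mem (U : G.left.Opens) : IsOpen {x : Points G | x.pt ∈ U} :=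
  U.isOpen.preimage continuous_induced_dom

/-- A point outside a Zariski closed set is separated from it by a regular function on any given
affine neighbourhood. -/
lemma exists_evalAt_ne_zero_of_notMem {U : G.left.Opens} (hU : IsAffineOpen U)
    {C : Set (Points G)} (hC : IsClosed C) {x : Points G} (hx : x.pt ∈ U) (hxC : x ∉ C) :
    ∃ f : Γ(G.left, U), evalAt f x ≠ 0 ∧ ∀ y ∈ C, evalAt f y = 0 := by
  obtain ⟨V, hV, hVC⟩ := isOpen_induced_iff.1 hC.isOpen_compl
  obtain ⟨f, hf, hxf⟩ := hU.exists_basicOpen_le (V := ⟨V, hV⟩)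
    ⟨x.pt, by have : x ∈ Points.pt ⁻¹' V := hVC ▸ hxC
              exact this⟩ hx
  refine ⟨f, (evalAt_ne_zero_iff f x).2 hxf, fun y hy => ?_⟩
  by_contra hne
  have : y ∈ Points.pt ⁻¹' V := hf ((evalAt_ne_zero_iff f y).1 hne)
  rw [hVC] at this
  exact this hy

instance finiteType_sections [LocallyOfFiniteType G.hom] (U : G.left.affineOpens) :
    Algebra.FiniteType ℂ Γ(G.left, U) := by
  have h1 := LocallyOfFiniteType.finiteType_appLE (f := G.hom) (isAffineOpen_top SpecC) U.2
    (le_preimage_top G U)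
  rw [← RingHom.finiteType_algebraMap]
  refine RingHom.FiniteType.comp (f := (Scheme.ΓSpecIso (CommRingCat.of ℂ)).inv.hom) h1 ?_
  exact RingHom.FiniteType.of_surjective _
    (ConcreteCategory.bijective_of_isIso (Scheme.ΓSpecIso (CommRingCat.of ℂ)).inv).2

lemma exists_isAffineOpen_mem (x : Points G) :
    ∃ U : G.left.Opens, IsAffineOpen U ∧ x.pt ∈ U := by
  obtain ⟨U, hU, hx, -⟩ := exists_isAffineOpen_mem_and_subset (U := ⊤) (x := x.pt) trivial
  exact ⟨U, hU, hx⟩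

lemma exists_point_mem [LocallyOfFiniteType G.hom] (U : G.left.Opens) (hU : U ≠ ⊥) :
    ∃ x : Points G, x.pt ∈ U := by
  obtain ⟨p, hp⟩ := (TopologicalSpace.Opens.ne_bot_iff_nonempty U).1 hU
  obtain ⟨V, hV, hpV, hVU⟩ := exists_isAffineOpen_mem_and_subset hp
  have := finiteType_sections (G := G) ⟨V, hV⟩
  have : Nonempty V := ⟨⟨p, hpV⟩⟩
  have : Nontrivial Γ(G.left, V) := inferInstance
  obtain ⟨χ⟩ := nonempty_algHom_of_finiteType (k := ℂ) Γ(G.left, V)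
  exact ⟨_, hVU (pointOfAlgHom_pt_mem hV χ)⟩

/-- On a reduced scheme of finite type, regular functions are determined by their values. -/
lemma eq_zero_of_evalAt [LocallyOfFiniteType G.hom] [IsReduced G.left] {U : G.left.Opens}
    (f : Γ(G.left, U)) (h : ∀ x : Points G, evalAt f x = 0) : f = 0 := by
  rw [← AlgebraicGeometry.basicOpen_eq_bot_iff]
  by_contra hne
  obtain ⟨x, hx⟩ := exists_point_mem _ hne
  exact (evalAt_ne_zero_iff f x).2 hx (h x)

lemma evalAt_zero {U : G.left.Opens} (x : Points G) : evalAt (0 : Γ(G.left, U)) x = 0 := by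
  by_cases hx : x.pt ∈ U
  · rw [← evalHom_apply hx, map_zero]
  · rw [evalAt_of_notMem _ hx]

lemma evalAt_add {U : G.left.Opens} {x : Points G} (f g : Γ(G.left, U)) :
    evalAt (f + g) x = evalAt f x + evalAt g x := by
  by_cases hx : x.pt ∈ U
  · simp only [← evalHom_apply hx, map_add]
  · simp [evalAt_of_notMem _ hx]

lemma evalAt_mul {U : G.left.Opens} {x : Points G} (f g : Γ(G.left, U)) :
    evalAt (f * g) x = evalAt f x * evalAt g x := by
  by_cases hx : x.pt ∈ U
  · simp only [← evalHom_apply hx, map_mul]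
  · simp [evalAt_of_notMem _ hx]

lemma evalAt_pow {U : G.left.Opens} {x : Points G} (hx : x.pt ∈ U) (f : Γ(G.left, U)) (n : ℕ) :
    evalAt (f ^ n) x = evalAt f x ^ n := by
  simp only [← evalHom_apply hx, map_pow]

lemma evalAt_smul {U : G.left.Opens} {x : Points G} (c : ℂ) (f : Γ(G.left, U)) :
    evalAt (c • f) x = c * evalAt f x := by
  by_cases hx : x.pt ∈ U
  · simp only [← evalHom_apply hx, map_smul, smul_eq_mul]
  · simp [evalAt_of_notMem _ hx]

/-- Near any point of an affine open set, regular functions are fractions of functions on it. -/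
lemma exists_fraction {U V : G.left.Opens} (hV : IsAffineOpen V) {x : Points G} (hxU : x.pt ∈ U)
    (hxV : x.pt ∈ V) (f : Γ(G.left, U)) :
    ∃ (b a : Γ(G.left, V)) (n : ℕ), evalAt b x ≠ 0 ∧ ∃ (hU : G.left.basicOpen b ≤ U),
      (G.left.presheaf.map (homOfLE hU).op).hom f *
        (G.left.presheaf.map (homOfLE (G.left.basicOpen_le b)).op).hom (b ^ n) =
      (G.left.presheaf.map (homOfLE (G.left.basicOpen_le b)).op).hom a := by
  obtain ⟨b, hb, hxb⟩ := hV.exists_basicOpen_le ⟨x.pt, hxU⟩ hxV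
  have := hV.isLocalization_basicOpen b
  obtain ⟨⟨a, ⟨_, n, rfl⟩⟩, h⟩ := IsLocalization.surj (Submonoid.powers b)
    ((G.left.presheaf.map (homOfLE hb).op).hom f)
  exact ⟨b, a, n, (evalAt_ne_zero_iff b x).2 hxb, hb, h⟩

end Points

/-! ### Holomorphic maps into the complex points. -/

section Holomorphic

open Filter Topology

variable {G H : Over SpecC} {X Y : Type*} [NormedAddCommGroup X] [NormedSpace ℂ X]
  [NormedAddCommGroup Y] [NormedSpace ℂ Y]

/-- Holomorphy at `x` of a map from a normed space to the complex points of a scheme. -/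
def HolomorphicAt (E : X → Points G) (x : X) : Prop :=
  ∀ U : G.left.Opens, (E x).pt ∈ U →
    (∀ᶠ y in 𝓝 x, (E y).pt ∈ U) ∧
      ∀ f : Γ(G.left, U), AnalyticAt ℂ (fun y => evalAt f (E y)) x

/-- The regular functions on `U` whose composition with `E` is analytic at `x`. -/
def analyticSubring (E : X → Points G) (x : X) (U : G.left.Opens)
    (hU : ∀ᶠ y in 𝓝 x, (E y).pt ∈ U) : Subring Γ(G.left, U) where
  carrier := {f | AnalyticAt ℂ (fun y => evalAt f (E y)) x}
  mul_mem' hf hg := by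
    simp only [Set.mem_ofPred_eq, evalAt_mul]
    exact hf.mul hg
  add_mem' hf hg := by
    simp only [Set.mem_ofPred_eq, evalAt_add]
    exact hf.add hg
  one_mem' := by
    refine (analyticAt_const (v := (1 : ℂ))).congr ?_
    filter_upwards [hU] with y hy
    rw [← evalHom_apply hy, map_one]
  zero_mem' := by
    refine (analyticAt_const (v := (0 : ℂ))).congr (Eventually.of_forall fun y => ?_)
    by_cases hy : (E y).pt ∈ U
    · simp only [← evalHom_apply hy, map_zero]
    · simp only [evalAt_of_notMem _ hy]
  neg_mem' {f} hf := by
    refine AnalyticAt.congr (f := fun y => -evalAt f (E y)) hf.neg ?_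
    filter_upwards [hU] with y hy
    simp only [← evalHom_apply hy, map_neg]

/-- Holomorphy can be tested on one affine neighbourhood. -/
lemma HolomorphicAt.of_isAffineOpen {E : X → Points G} {x : X} {V : G.left.Opens}
    (hV : IsAffineOpen V) (hx : ∀ᶠ y in 𝓝 x, (E y).pt ∈ V)
    (hf : ∀ f : Γ(G.left, V), AnalyticAt ℂ (fun y => evalAt f (E y)) x) : HolomorphicAt E x := by
  intro U hU
  have key : ∀ b : Γ(G.left, V), evalAt b (E x) ≠ 0 →
      ∀ᶠ y in 𝓝 x, evalAt b (E y) ≠ 0 := fun b hb => (hf b).continuousAt.eventually_ne hb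
  constructor
  · obtain ⟨b, a, n, hb, hbU, -⟩ := exists_fraction hV hU hx.self_of_nhds
      (0 : Γ(G.left, U))
    filter_upwards [key b hb] with y hy
    exact hbU ((evalAt_ne_zero_iff b _).1 hy)
  · intro f
    obtain ⟨b, a, n, hb, hbU, h⟩ := exists_fraction hV hU hx.self_of_nhds f
    refine AnalyticAt.congr (f := fun y => evalAt a (E y) / evalAt b (E y) ^ n)
      ((hf a).div ((hf b).pow n) (pow_ne_zero n hb)) ?_
    filter_upwards [key b hb] with y hy
    have hyb := (evalAt_ne_zero_iff b _).1 hy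
    have h' := congrArg (fun g => evalAt g (E y)) h
    simp only [evalAt_mul, evalAt_res _ _ hyb, evalAt_pow (G.left.basicOpen_le b hyb)] at h'
    rw [← h', mul_div_cancel_right₀ _ (pow_ne_zero n hy)]

lemma HolomorphicAt.map {E : X → Points G} {x : X} (hE : HolomorphicAt E x) (t : G ⟶ H) :
    HolomorphicAt (fun y => (E y).map t) x := by
  intro U hU
  obtain ⟨h1, h2⟩ := hE (t.left ⁻¹ᵁ U) hU
  refine ⟨h1, fun f => ?_⟩
  simp only [evalAt_map]
  exact h2 _

lemma HolomorphicAt.comp {E : X → Points G} {g : Y → X} {y : Y} (hE : HolomorphicAt E (g y))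
    (hg : AnalyticAt ℂ g y) : HolomorphicAt (fun z => E (g z)) y := by
  intro U hU
  obtain ⟨h1, h2⟩ := hE U hU
  exact ⟨hg.continuousAt.eventually h1, fun f => (h2 f).comp hg⟩

lemma holomorphicAt_const (p : Points G) (x : X) : HolomorphicAt (fun _ => p) x :=
  fun _ hU => ⟨Eventually.of_forall fun _ => hU, fun _ => analyticAt_const⟩

/-- A subring of a pushout of commutative rings which contains both factors is everything. -/
lemma mem_subring_of_isPushout {A B C P : CommRingCat.{0}} {f : A ⟶ B} {g : A ⟶ C} {inl : B ⟶ P}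
    {inr : C ⟶ P} (h : IsPushout f g inl inr) (R : Subring P) (hl : ∀ b, inl.hom b ∈ R)
    (hr : ∀ c, inr.hom c ∈ R) (z : P) : z ∈ R := by
  let inl' : B ⟶ CommRingCat.of R := CommRingCat.ofHom (inl.hom.codRestrict R hl)
  let inr' : C ⟶ CommRingCat.of R := CommRingCat.ofHom (inr.hom.codRestrict R hr)
  let i : CommRingCat.of R ⟶ P := CommRingCat.ofHom R.subtype
  have hw : f ≫ inl' = g ≫ inr' := by
    ext a
    exact congrArg (fun φ : A ⟶ P => φ.hom a) h.w
  have hid : h.desc inl' inr' hw ≫ i = 𝟙 P := by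
    apply h.hom_ext
    · rw [IsPushout.inl_desc_assoc, Category.comp_id]; rfl
    · rw [IsPushout.inr_desc_assoc, Category.comp_id]; rfl
  have hz : i.hom ((h.desc inl' inr' hw).hom z) = z := congr(($hid).hom z)
  rw [← hz]
  exact ((h.desc inl' inr' hw).hom z).2

/-- The pair of two complex points, as a complex point of the product. -/
def Points.pair (x : Points G) (y : Points H) : Points (G ⊗ H) := lift x.toHom y.toHom

lemma Points.pair_map_fst (x : Points G) (y : Points H) : (x.pair y).map (fst G H) = x :=
  lift_fst _ _

lemma Points.pair_map_snd (x : Points G) (y : Points H) : (x.pair y).map (snd G H) = y :=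
  lift_snd _ _

lemma isPullback_tensorObj (G H : Over SpecC) :
    IsPullback (fst G H).left (snd G H).left G.hom H.hom := by
  rw [Over.fst_left, Over.snd_left]
  exact IsPullback.of_hasPullback _ _

/-- A pair of holomorphic maps is holomorphic. -/
lemma HolomorphicAt.pair {E : X → Points G} {F : X → Points H} {x : X}
    (hE : HolomorphicAt E x) (hF : HolomorphicAt F x) :
    HolomorphicAt (fun y => (E y).pair (F y)) x := by
  obtain ⟨U, hU, hxU⟩ := exists_isAffineOpen_mem (E x)
  obtain ⟨V, hV, hxV⟩ := exists_isAffineOpen_mem (F x)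
  obtain ⟨hE1, hE2⟩ := hE U hxU
  obtain ⟨hF1, hF2⟩ := hF V hxV
  let W : (G ⊗ H).left.Opens := (fst G H).left ⁻¹ᵁ U ⊓ (snd G H).left ⁻¹ᵁ V
  have hmem : ∀ y, ((E y).pair (F y)).pt ∈ W ↔ (E y).pt ∈ U ∧ (F y).pt ∈ V := by
    intro y
    have h1 : (fst G H).left ((E y).pair (F y)).pt = (E y).pt := by
      rw [← Points.map_pt, Points.pair_map_fst]
    have h2 : (snd G H).left ((E y).pair (F y)).pt = (F y).pt := by
      rw [← Points.map_pt, Points.pair_map_snd]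
    rw [← h1, ← h2]; rfl
  have hW : ∀ᶠ y in 𝓝 x, ((E y).pair (F y)).pt ∈ W := by
    filter_upwards [hE1, hF1] with y h1 h2 using (hmem y).2 ⟨h1, h2⟩
  have hpull := isPullback_tensorObj G H
  have hres := Scheme.Hom.isPullback_resLE hpull (US := ⊤) (UT := V) (UX := U) (UY := W)
    le_top le_top rfl
  have hWaff : IsAffineOpen W := by
    have : IsAffine _ := hU
    have : IsAffine _ := hV
    have : IsAffine _ := isAffineOpen_top SpecC
    exact .of_isIso hres.isoPullback.hom
  have hpush := (isIso_pushoutSection_iff hpull (US := ⊤) (UT := V) (UX := U) (UY := W)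
    le_top le_top rfl).1 (isIso_pushoutSection_of_isAffineOpen hpull le_top le_top rfl
      (isAffineOpen_top SpecC) hV hU)
  refine HolomorphicAt.of_isAffineOpen hWaff hW fun f => ?_
  -- Functions on a product of affine open sets are generated by those of the two factors, so
  -- analyticity need only be checked on pullbacks from each factor.
  refine mem_subring_of_isPushout hpush
    (analyticSubring (fun y => (E y).pair (F y)) x W hW) (fun b => ?_) (fun c => ?_) f
  · refine AnalyticAt.congr (hE2 b) ?_
    filter_upwards [hW] with y hy
    conv_lhs => rw [← Points.pair_map_fst (E y) (F y), evalAt_map]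
    exact (evalAt_res (inf_le_left : W ≤ _) _ hy).symm
  · refine AnalyticAt.congr (hF2 c) ?_
    filter_upwards [hW] with y hy
    conv_lhs => rw [← Points.pair_map_snd (E y) (F y), evalAt_map]
    exact (evalAt_res (inf_le_right : W ≤ _) _ hy).symm

lemma HolomorphicAt.mul [GrpObj G] {E F : X → Points G} {x : X}
    (hE : HolomorphicAt E x) (hF : HolomorphicAt F x) :
    HolomorphicAt (fun y => E y * F y) x :=
  (hE.pair hF).map μ

lemma Points.map_leftTranslation [GrpObj G] (g x : Points G) :
    x.map (leftTranslation g) = g * x := by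
  have key : ∀ p q : 𝟙_ (Over SpecC) ⟶ G,
      p ≫ lift (toUnit G ≫ q) (𝟙 G) ≫ μ = lift q p ≫ μ := by
    intro p q
    rw [comp_lift_assoc, Category.comp_id, ← Category.assoc, toUnit_unique (p ≫ toUnit G) (𝟙 _),
      Category.id_comp]
  exact key x.toHom g.toHom

end Holomorphic

/-! ### One-parameter subgroups and the Lie algebra. -/

section OneParameterSubgroups

open Filter Topology

variable {G : Over SpecC} [GrpObj G]

/-- The complex points of a commutative group scheme form a commutative group. -/
abbrev Points.commGroup [IsCommMonObj G] : CommGroup (Points G) where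
  mul_comm x y := mul_comm (G := 𝟙_ (Over SpecC) ⟶ G) x y

attribute [local instance] Points.commGroup

lemma evalAt_mul_left (g x : Points G) {U : G.left.Opens} (f : Γ(G.left, U)) :
    evalAt f (g * x) = evalAt (((leftTranslation g).left.app U).hom f) x := by
  rw [← Points.map_leftTranslation, evalAt_map]

namespace IsOneParameterSubgroup

variable {D E : lieAlg G} {φ ψ : ℂ → Points G}

lemma map_zero (hφ : IsOneParameterSubgroup D φ) : φ 0 = 1 := by
  have := hφ.map_add 0 0
  rwa [add_zero, left_eq_mul] at this

lemma holomorphicAt (hφ : IsOneParameterSubgroup D φ) (t : ℂ) : HolomorphicAt φ t := by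
  intro U hU
  refine ⟨(hφ.isOpen_preimage U).mem_nhds hU, fun f => ?_⟩
  exact DifferentiableOn.analyticAt
    (fun s hs => (hφ.hasDerivAt U f s hs).differentiableAt.differentiableWithinAt)
    ((hφ.isOpen_preimage U).mem_nhds hU)

lemma hasDerivAt_mul_left (hφ : IsOneParameterSubgroup D φ) (g : Points G) {U : G.left.Opens}
    (f : Γ(G.left, U)) {t : ℂ} (ht : (g * φ t).pt ∈ U) :
    HasDerivAt (fun s => evalAt f (g * φ s)) (evalAt (D.1 U f) (g * φ t)) t := by
  simp only [evalAt_mul_left]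
  rw [← D.2.2 g U f]
  refine hφ.hasDerivAt _ _ t ?_
  rwa [← Points.map_leftTranslation] at ht

lemma zero : IsOneParameterSubgroup (0 : lieAlg G) (fun _ => 1) where
  map_add _ _ := (_root_.one_mul 1).symm
  isOpen_preimage _ := isOpen_const
  hasDerivAt U f t _ := by
    have : (0 : lieAlg G).1 U f = 0 := rfl
    rw [this, evalAt_zero]
    exact hasDerivAt_const _ _

lemma smul (hφ : IsOneParameterSubgroup D φ) (c : ℂ) :
    IsOneParameterSubgroup (c • D) (fun t => φ (c * t)) where
  map_add s t := by rw [mul_add, hφ.map_add]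
  isOpen_preimage U := (hφ.isOpen_preimage U).preimage (continuous_const_mul c)
  hasDerivAt U f t ht := by
    have h1 : (c • D).1 U f = c • D.1 U f := rfl
    rw [h1, evalAt_smul, mul_comm]
    have h2 : HasDerivAt (fun s : ℂ => c * s) c t := by
      simpa using (hasDerivAt_id t).const_mul c
    exact (hφ.hasDerivAt U f (c * t) ht).comp t h2

/-- The two-variable map (s, t) ↦ φ(s)ψ(t) is holomorphic. By left invariance and commutativity its
partial derivatives along the diagonal are given by D and E, and the chain rule adds them. -/
lemma add [IsCommMonObj G] (hφ : IsOneParameterSubgroup D φ) (hψ : IsOneParameterSubgroup E ψ) :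
    IsOneParameterSubgroup (D + E) (fun t => φ t * ψ t) where
  map_add s t := by rw [hφ.map_add, hψ.map_add, _root_.mul_mul_mul_comm]
  isOpen_preimage U := isOpen_iff_eventually.2 fun t ht =>
    (((hφ.holomorphicAt t).mul (hψ.holomorphicAt t)) U ht).1
  hasDerivAt U f t ht := by
    have hol : HolomorphicAt (fun p : ℂ × ℂ => φ p.1 * ψ p.2) (t, t) :=
      HolomorphicAt.mul
        (HolomorphicAt.comp (g := Prod.fst) (hφ.holomorphicAt t) analyticAt_fst)
        (HolomorphicAt.comp (g := Prod.snd) (hψ.holomorphicAt t) analyticAt_snd)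
    have hL := ((hol U ht).2 f).differentiableAt.hasFDerivAt
    set L := fderiv ℂ (fun p : ℂ × ℂ => evalAt f (φ p.1 * ψ p.2)) (t, t)
    have h1 : HasDerivAt (fun s : ℂ => (s, t)) (1, 0) t :=
      (hasDerivAt_id t).prodMk (hasDerivAt_const t t)
    have h2 : HasDerivAt (fun s : ℂ => (t, s)) (0, 1) t :=
      (hasDerivAt_const t t).prodMk (hasDerivAt_id t)
    have h3 : HasDerivAt (fun s : ℂ => (s, s)) (1, 1) t :=
      (hasDerivAt_id t).prodMk (hasDerivAt_id t)
    have e1 : L (1, 0) = evalAt (D.1 U f) (φ t * ψ t) := by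
      refine (HasFDerivAt.comp_hasDerivAt (f := fun s : ℂ => (s, t)) t hL h1).unique ?_
      have ht' : (ψ t * φ t).pt ∈ U := by rwa [mul_comm]
      have := hφ.hasDerivAt_mul_left (ψ t) f ht'
      simp only [mul_comm (ψ t)] at this
      exact this
    have e2 : L (0, 1) = evalAt (E.1 U f) (φ t * ψ t) :=
      (HasFDerivAt.comp_hasDerivAt (f := fun s : ℂ => (t, s)) t hL h2).unique
        (hψ.hasDerivAt_mul_left (φ t) f ht)
    have e3 : evalAt ((D + E).1 U f) (φ t * ψ t) = L (1, 1) := by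
      have : (D + E).1 U f = D.1 U f + E.1 U f := rfl
      rw [this, evalAt_add, ← e1, ← e2, ← _root_.map_add, Prod.mk_add_mk, add_zero, zero_add]
    rw [e3]
    exact HasFDerivAt.comp_hasDerivAt (f := fun s : ℂ => (s, s)) t hL h3

lemma prod [IsCommMonObj G] {I : Type*} {D : I → lieAlg G} {φ : I → ℂ → Points G}
    (hφ : ∀ i, IsOneParameterSubgroup (D i) (φ i)) (s : Finset I) :
    IsOneParameterSubgroup (∑ i ∈ s, D i) (fun t => ∏ i ∈ s, φ i t) := by
  classical
  induction s using Finset.induction_on with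
  | empty => simpa using zero
  | insert i s hi ih =>
    simp only [Finset.sum_insert hi, Finset.prod_insert hi]
    exact (hφ i).add ih

lemma map_natCast_mul (hφ : IsOneParameterSubgroup D φ) (n : ℕ) (t : ℂ) :
    φ (n * t) = φ t ^ n := by
  induction n with
  | zero => simp [hφ.map_zero]
  | succ n ih => rw [Nat.cast_succ, add_mul, _root_.one_mul, hφ.map_add, ih, pow_succ]

variable [LocallyOfFiniteType G.hom]

/-- Functions on an affine neighbourhood of 1 have zero derivative along φ, so φ is constant near 0;
writing t = n · (t/n) with n large propagates this to all of ℂ. -/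
lemma eq_one (hφ : IsOneParameterSubgroup (0 : lieAlg G) φ) (t : ℂ) : φ t = 1 := by
  obtain ⟨V, hV, h1V⟩ := exists_isAffineOpen_mem (1 : Points G)
  have hopen := hφ.isOpen_preimage V
  obtain ⟨r, hr, hball⟩ := Metric.isOpen_iff.1 hopen 0 (by
    change (φ 0).pt ∈ V
    rwa [hφ.map_zero])
  have hone : ∀ s ∈ Metric.ball (0 : ℂ) r, φ s = 1 := by
    intro s hs
    refine Points.ext_of_evalAt hV (hball hs) h1V fun f => ?_
    have hd : ∀ u ∈ Metric.ball (0 : ℂ) r, HasDerivAt (fun s => evalAt f (φ s)) 0 u := by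
      intro u hu
      have := hφ.hasDerivAt V f u (hball hu)
      rwa [show (0 : lieAlg G).1 V f = 0 from rfl, evalAt_zero] at this
    rw [← hφ.map_zero]
    refine Metric.isOpen_ball.is_const_of_deriv_eq_zero (𝕜 := ℂ)
      (convex_ball (0 : ℂ) r).isPreconnected
      (fun u hu => (hd u hu).differentiableAt.differentiableWithinAt)
      (fun u hu => (hd u hu).deriv) hs (Metric.mem_ball_self hr)
  obtain ⟨n, hn⟩ := exists_nat_gt (‖t‖ / r)
  have hn0 : (0 : ℝ) < n := lt_of_le_of_lt (by positivity) hn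
  have hnC : (n : ℂ) ≠ 0 := by
    intro h
    have : (n : ℝ) = 0 := by exact_mod_cast h
    exact hn0.ne' this
  have ht : t = n * (t / n) := by field_simp
  rw [ht, hφ.map_natCast_mul, hone, one_pow]
  rw [mem_ball_zero_iff, norm_div, Complex.norm_natCast, div_lt_iff₀ hn0]
  rw [div_lt_iff₀ hr] at hn
  linarith

/-- The product φ(t)ψ(-t) is a one-parameter subgroup for D - D = 0, hence trivial. -/
lemma unique [IsCommMonObj G] (hφ : IsOneParameterSubgroup D φ)
    (hψ : IsOneParameterSubgroup D ψ) : φ = ψ := by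
  funext t
  have h : IsOneParameterSubgroup (0 : lieAlg G) (fun t => φ t * ψ (-1 * t)) := by
    have := hφ.add (hψ.smul (-1))
    rwa [neg_one_smul, add_neg_cancel] at this
  have h1 := h.eq_one t
  have h2 : ψ (-1 * t) * ψ t = 1 := by
    rw [← hψ.map_add, neg_one_mul, neg_add_cancel, hψ.map_zero]
  exact (eq_inv_of_mul_eq_one_left h1).trans (eq_inv_of_mul_eq_one_right h2).symm

end IsOneParameterSubgroup

variable [LocallyOfFiniteType G.hom]

/-- A left invariant vector field which vanishes at the identity is zero. -/
lemma lieAlg_eq_zero [IsReduced G.left] {V : G.left.Opens} (hV : IsAffineOpen V)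
    (h1V : (1 : Points G).pt ∈ V) (D : lieAlg G)
    (hD : ∀ f : Γ(G.left, V), evalAt (D.1 V f) (1 : Points G) = 0) : D = 0 := by
  have hone : ∀ (W : G.left.Opens) (g : Γ(G.left, W)), (1 : Points G).pt ∈ W →
      evalAt (D.1 W g) (1 : Points G) = 0 := by
    intro W g hW
    obtain ⟨b, a, n, hb, hbW, h⟩ := exists_fraction hV hW h1V g
    have h1b := (evalAt_ne_zero_iff b _).1 hb
    -- Apply D to g bⁿ = a and evaluate at 1: every term vanishes by hypothesis except b(1)ⁿ
    -- (Dg)(1).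
    have h2 := congrArg (fun u => evalAt (D.1 _ u) (1 : Points G)) h
    simp only [Derivation.leibniz, D.2.1, smul_eq_mul, evalAt_add, evalAt_mul,
      evalAt_res _ _ h1b, hD, mul_zero, zero_add] at h2
    rw [evalAt_pow h1V] at h2
    exact (mul_eq_zero.1 h2).resolve_left (pow_ne_zero n hb)
  refine Subtype.ext (funext fun U => Derivation.ext fun f => ?_)
  refine eq_zero_of_evalAt _ fun x => ?_
  by_cases hx : x.pt ∈ U
  -- Left invariance carries the vanishing from 1 to x.
  · have : evalAt (D.1 U f) (x * 1) = 0 := by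
      rw [evalAt_mul_left, ← D.2.2 x U f]
      refine hone _ _ ?_
      change ((1 : Points G).map (leftTranslation x)).pt ∈ U
      rwa [Points.map_leftTranslation, _root_.mul_one]
    rwa [_root_.mul_one] at this
  · exact evalAt_of_notMem _ hx

/-- An invariant field is determined by its values at 1 on finitely many generators of the functions
on an affine neighbourhood. -/
instance finiteDimensional_lieAlg [IsReduced G.left] : FiniteDimensional ℂ (lieAlg G) := by
  obtain ⟨V, hV, h1V⟩ := exists_isAffineOpen_mem (1 : Points G)
  have hft : Algebra.FiniteType ℂ Γ(G.left, V) := finiteType_sections (G := G) ⟨V, hV⟩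
  obtain ⟨s, hs⟩ := hft.1
  let L : lieAlg G →ₗ[ℂ] (s → ℂ) :=
    { toFun := fun D i => evalAt (D.1 V i.1) (1 : Points G)
      map_add' := fun D E => funext fun i => evalAt_add _ _
      map_smul' := fun c D => funext fun i => evalAt_smul _ _ }
  refine FiniteDimensional.of_injective L ((injective_iff_map_eq_zero L).2 fun D hD => ?_)
  refine lieAlg_eq_zero hV h1V D fun f => ?_
  have hf : f ∈ Algebra.adjoin ℂ (s : Set Γ(G.left, V)) := hs ▸ Algebra.mem_top
  induction hf using Algebra.adjoin_induction with
  | mem x hx => exact congrFun hD ⟨x, hx⟩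
  | algebraMap c => rw [Derivation.map_algebraMap, evalAt_zero]
  | add x y _ _ hx hy => rw [map_add, evalAt_add, hx, hy, add_zero]
  | mul x y _ _ hx hy =>
    rw [Derivation.leibniz, smul_eq_mul, smul_eq_mul, evalAt_add, evalAt_mul, evalAt_mul, hx, hy,
      mul_zero, mul_zero, add_zero]

variable [IsCommMonObj G]

/-- The exponential of a Lie subalgebra `h` lies in the image of a holomorphic homomorphism from a
vector space of dimension at most `dim h`. -/
lemma exists_holomorphic_hom [IsReduced G.left] (h : LieSubalgebra ℂ (lieAlg G)) :
    ∃ d ≤ Module.finrank ℂ h, ∃ E : (Fin d → ℂ) → Points G, (∀ x, HolomorphicAt E x) ∧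
      (∀ x y, E (x + y) = E x * E y) ∧ exp '' (h : Set (lieAlg G)) ⊆ Set.range E := by
  -- Restricting to the fields that do generate a one-parameter subgroup avoids proving that all of
  -- them do; commutativity makes these fields a subspace.
  let h' : Submodule ℂ (lieAlg G) :=
    { carrier := {D | D ∈ h ∧ ∃ φ, IsOneParameterSubgroup D φ}
      zero_mem' := ⟨h.zero_mem, _, .zero⟩
      add_mem' := fun ⟨h1, φ, hφ⟩ ⟨h2, ψ, hψ⟩ => ⟨h.add_mem h1 h2, _, hφ.add hψ⟩
      smul_mem' := fun c _ ⟨h1, φ, hφ⟩ => ⟨h.smul_mem c h1, _, hφ.smul c⟩ }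
  let b := Module.finBasis ℂ h'
  choose φ hφ using fun i => (b i).2.2
  let E : (Fin (Module.finrank ℂ h') → ℂ) → Points G := fun t => ∏ i, φ i (t i)
  have hmul : ∀ x y, E (x + y) = E x * E y := fun x y => by
    simp only [E, Pi.add_apply, (hφ _).map_add, Finset.prod_mul_distrib]
  refine ⟨_, Submodule.finrank_mono (t := h.toSubmodule) fun D (hD : D ∈ h') => hD.1, E,
    fun x => ?_, hmul, ?_⟩
  · have : ∀ s : Finset (Fin (Module.finrank ℂ h')),
        HolomorphicAt (fun t : Fin (Module.finrank ℂ h') → ℂ => ∏ i ∈ s, φ i (t i)) x := by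
      intro s
      induction s using Finset.induction_on with
      | empty => simpa using holomorphicAt_const 1 x
      | insert i s hi ih =>
        simp only [Finset.prod_insert hi]
        refine HolomorphicAt.mul (HolomorphicAt.comp
          (g := fun t : Fin (Module.finrank ℂ h') → ℂ => t i) ((hφ i).holomorphicAt (x i)) ?_) ih
        exact (ContinuousLinearMap.proj (R := ℂ) (φ := fun _ => ℂ) i).analyticAt x
    exact this _
  · rintro _ ⟨D, hD, rfl⟩
    by_cases hex : ∃ χ, IsOneParameterSubgroup D χ
    · have hexp : exp D = hex.choose 1 := dif_pos hex
      let D' : h' := ⟨D, hD, hex⟩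
      have hsum : ∑ i, b.repr D' i • (b i : lieAlg G) = D := by
        have := congrArg h'.subtype (b.sum_repr D')
        rwa [map_sum] at this
      -- By uniqueness the subgroup chosen in `exp` is the product of the t ↦ φᵢ(cᵢt), with cᵢ the
      -- coordinates of D; at t = 1 this is E(c).
      have h1 := IsOneParameterSubgroup.prod (fun i => (hφ i).smul (b.repr D' i)) Finset.univ
      rw [hsum] at h1
      refine ⟨fun i => b.repr D' i, ?_⟩
      rw [hexp, hex.choose_spec.unique h1]
      simp only [E, _root_.mul_one]
    -- Here `exp` takes its default value 1, which is E(0).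
    · have hexp : exp D = 1 := dif_neg hex
      refine ⟨0, ?_⟩
      have := hmul 0 0
      rw [add_zero, left_eq_mul] at this
      rw [hexp, this]

end OneParameterSubgroups

open Pointwise

/-! ### Images of affine schemes, and vanishing ideals. -/

section AffineImages

variable {G : Over SpecC}

/-- Images of the complex points of an affine scheme of finite type under a morphism to `G`. -/
def IsAffineImage (Z : Set (Points G)) : Prop :=
  ∃ (X : Over SpecC) (β : X ⟶ G), IsAffine X.left ∧ LocallyOfFiniteType X.hom ∧
    Z = Set.range (Points.map β)

/-- Points of X × Y are pairs of points, so the product set is the image of X × Y under β × δ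
followed by multiplication. -/
lemma IsAffineImage.mul [GrpObj G] {Z Z' : Set (Points G)} (hZ : IsAffineImage Z)
    (hZ' : IsAffineImage Z') : IsAffineImage (Z * Z') := by
  obtain ⟨X, β, hX, hXf, rfl⟩ := hZ
  obtain ⟨Y, δ, hY, hYf, rfl⟩ := hZ'
  refine ⟨X ⊗ Y, (β ⊗ₘ δ) ≫ μ, ?_, ?_, ?_⟩
  · rw [Over.tensorObj_left]
    infer_instance
  · rw [Over.tensorObj_hom]
    infer_instance
  · have key : ∀ p : Points X, ∀ q : Points Y,
        (p.pair q).map ((β ⊗ₘ δ) ≫ μ) = p.map β * q.map δ := by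
      intro p q
      have : ∀ (p : 𝟙_ (Over SpecC) ⟶ X) (q : 𝟙_ (Over SpecC) ⟶ Y),
          lift p q ≫ (β ⊗ₘ δ) ≫ μ = lift (p ≫ β) (q ≫ δ) ≫ μ := by
        intro p q
        rw [lift_map_assoc]
      exact this p.toHom q.toHom
    ext z
    constructor
    · rintro ⟨_, ⟨p, rfl⟩, _, ⟨q, rfl⟩, rfl⟩
      exact ⟨p.pair q, key p q⟩
    · rintro ⟨r, rfl⟩
      refine ⟨_, ⟨r.map (fst X Y), rfl⟩, _, ⟨r.map (snd X Y), rfl⟩, ?_⟩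
      refine (key _ _).symm.trans (congrArg (Points.map ((β ⊗ₘ δ) ≫ μ)) ?_)
      have : ∀ r : 𝟙_ (Over SpecC) ⟶ X ⊗ Y, lift (r ≫ fst X Y) (r ≫ snd X Y) = r := by
        intro r
        rw [← comp_lift, lift_fst_snd, Category.comp_id]
      exact this r.toHom

lemma IsAffineImage.inv [GrpObj G] {Z : Set (Points G)} (hZ : IsAffineImage Z) :
    IsAffineImage Z⁻¹ := by
  obtain ⟨X, β, hX, hXf, rfl⟩ := hZ
  refine ⟨X, β ≫ ι, hX, hXf, ?_⟩
  have key : ∀ p : Points X, p.map (β ≫ ι) = (p.map β)⁻¹ := fun p =>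
    (Category.assoc p.toHom β ι).symm
  rw [← Set.image_inv_eq_inv, ← Set.range_comp]
  exact congrArg Set.range (funext fun p => (key p).symm)

lemma IsAffineImage.pow_succ [GrpObj G] {Z : Set (Points G)} (hZ : IsAffineImage Z) (n : ℕ) :
    IsAffineImage (Z ^ (n + 1)) := by
  induction n with
  | zero => simpa using hZ
  | succ n ih =>
    rw [_root_.pow_succ]
    exact ih.mul hZ

/-- The functions on `U` which vanish on a set of complex points. -/
def vanishingIdeal (U : G.left.Opens) (Z : Set (Points G)) : Ideal Γ(G.left, U) where
  carrier := {f | ∀ x ∈ Z, evalAt f x = 0}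
  zero_mem' x _ := evalAt_zero x
  add_mem' hf hg x hx := by rw [evalAt_add, hf x hx, hg x hx, add_zero]
  smul_mem' c f hf x hx := by rw [smul_eq_mul, evalAt_mul, hf x hx, mul_zero]

lemma mem_vanishingIdeal {U : G.left.Opens} {Z : Set (Points G)} {f : Γ(G.left, U)} :
    f ∈ vanishingIdeal U Z ↔ ∀ x ∈ Z, evalAt f x = 0 := Iff.rfl

lemma vanishingIdeal_anti {U : G.left.Opens} {Z Z' : Set (Points G)} (h : Z ⊆ Z') :
    vanishingIdeal U Z' ≤ vanishingIdeal U Z := fun _ hf x hx => hf x (h hx)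

lemma isOpen_setOf_evalAt_ne_zero {U : G.left.Opens} (f : Γ(G.left, U)) :
    IsOpen {x : Points G | evalAt f x ≠ 0} := by
  simp only [evalAt_ne_zero_iff]
  exact Points.isOpen_setOf_pt_mem _

lemma vanishingIdeal_closure (U : G.left.Opens) (Z : Set (Points G)) :
    vanishingIdeal U (closure Z) = vanishingIdeal U Z := by
  refine le_antisymm (vanishingIdeal_anti subset_closure) fun f hf => ?_
  have hcl : IsClosed {x : Points G | evalAt f x = 0} :=
    ⟨isOpen_setOf_evalAt_ne_zero f⟩
  exact fun x hx => closure_minimal (fun z hz => hf z hz) hcl hx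

lemma vanishingIdeal_isPrime {U : G.left.Opens} {Z : Set (Points G)} (hZ : IsIrreducible Z)
    (hZU : ∃ x ∈ Z, x.pt ∈ U) : (vanishingIdeal U Z).IsPrime := by
  obtain ⟨x, hxZ, hxU⟩ := hZU
  refine ⟨fun h => ?_, fun {f g} hfg => ?_⟩
  · have h1 : (1 : Γ(G.left, U)) ∈ vanishingIdeal U Z := h ▸ Submodule.mem_top
    have := h1 x hxZ
    rw [← evalHom_apply hxU, _root_.map_one] at this
    exact one_ne_zero this
  · by_contra hne
    simp only [mem_vanishingIdeal, not_or, not_forall] at hne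
    obtain ⟨⟨y, hy, hfy⟩, ⟨z, hz, hgz⟩⟩ := hne
    obtain ⟨w, hw, hfw, hgw⟩ := hZ.2 _ _ (isOpen_setOf_evalAt_ne_zero f)
      (isOpen_setOf_evalAt_ne_zero g) ⟨y, hy, hfy⟩ ⟨z, hz, hgz⟩
    have := hfg w hw
    rw [evalAt_mul] at this
    exact mul_ne_zero hfw hgw this

/-- By irreducibility of Z', its nonempty open subsets Z' \ Z and Z' ∩ U meet; a function on U
separates a common point from Z. -/
lemma vanishingIdeal_lt {U : G.left.Opens} (hU : IsAffineOpen U) {Z Z' : Set (Points G)}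
    (hZ : IsClosed Z) (hZ' : IsIrreducible Z') (hZU : ∃ x ∈ Z', x.pt ∈ U) (hlt : Z < Z') :
    vanishingIdeal U Z' < vanishingIdeal U Z := by
  refine lt_of_le_of_ne (vanishingIdeal_anti hlt.le) fun heq => ?_
  obtain ⟨y, hyZ', hyZ⟩ := Set.exists_of_ssubset hlt
  obtain ⟨x, hxZ', hxU⟩ := hZU
  obtain ⟨z, hzZ', hzZ, hzU⟩ := hZ'.2 _ _ hZ.isOpen_compl (Points.isOpen_setOf_pt_mem U)
    ⟨y, hyZ', hyZ⟩ ⟨x, hxZ', hxU⟩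
  obtain ⟨f, hfz, hf⟩ := exists_evalAt_ne_zero_of_notMem hU hZ hzU hzZ
  have : f ∈ vanishingIdeal U Z' := heq ▸ mem_vanishingIdeal.2 hf
  exact hfz (this z hzZ')

/-- The affine scheme is the spectrum of Γ(U)/I, with I the ideal of S ∩ U. Evaluation at a point of
S ∩ U factors through the quotient; conversely, a function separating a point of U from S would lie
in I. -/
lemma isAffineImage_inter [LocallyOfFiniteType G.hom] {S : Set (Points G)} (hS : IsClosed S)
    {U : G.left.Opens} (hU : IsAffineOpen U) : IsAffineImage (S ∩ {x | x.pt ∈ U}) := by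
  have := finiteType_sections (G := G) ⟨U, hU⟩
  let I := vanishingIdeal U (S ∩ {x | x.pt ∈ U})
  let π : Γ(G.left, U) ⟶ CommRingCat.of (Γ(G.left, U) ⧸ I) :=
    CommRingCat.ofHom (Ideal.Quotient.mk I)
  let j : Spec (CommRingCat.of (Γ(G.left, U) ⧸ I)) ⟶ G.left := Spec.map π ≫ hU.fromSpec
  have hπ : IsClosedImmersion (Spec.map π) :=
    IsClosedImmersion.spec_of_surjective _ Ideal.Quotient.mk_surjective
  refine ⟨Over.mk (j ≫ G.hom), Over.homMk j rfl, ?_, ?_, ?_⟩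
  · change IsAffine (Spec _)
    infer_instance
  · change LocallyOfFiniteType ((Spec.map π ≫ hU.fromSpec) ≫ G.hom)
    infer_instance
  ext x
  constructor
  · rintro ⟨hxS, hxU⟩
    have hker : ∀ f ∈ I, (evalHom U x hxU).toRingHom f = 0 := fun f hf =>
      (evalHom_apply hxU f).trans (hf x ⟨hxS, hxU⟩)
    let θ : CommRingCat.of (Γ(G.left, U) ⧸ I) ⟶ CommRingCat.of ℂ :=
      CommRingCat.ofHom (Ideal.Quotient.lift I (evalHom U x hxU).toRingHom hker)
    have hθ : π ≫ θ = CommRingCat.ofHom (evalHom U x hxU).toRingHom := by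
      ext f
      rfl
    have hθj : Spec.map θ ≫ j =
        Spec.map (CommRingCat.ofHom (evalHom U x hxU).toRingHom) ≫ hU.fromSpec := by
      rw [← hθ, Spec.map_comp, Category.assoc]
    have hw : Spec.map θ ≫ j ≫ G.hom = 𝟙 _ := by
      rw [← Category.assoc, hθj]
      exact SpecMap_fromSpec_hom hU _
    let p : Points (Over.mk (j ≫ G.hom)) := Over.homMk (U := 𝟙_ (Over SpecC)) (Spec.map θ) hw
    refine ⟨p, ?_⟩
    have h1 : p.map (Over.homMk j rfl) = pointOfAlgHom hU (evalHom U x hxU) :=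
      Over.OverMorphism.ext hθj
    rw [h1]
    exact Points.ext_of_evalAt hU (pointOfAlgHom_pt_mem hU _) hxU fun f => by
      rw [evalAt_pointOfAlgHom, evalHom_apply]
  · rintro ⟨p, rfl⟩
    set x := p.map (Over.homMk j rfl : Over.mk (j ≫ G.hom) ⟶ G) with hx
    have hjU : ∀ y, j y ∈ U := by
      intro y
      rw [← SetLike.mem_coe, ← hU.range_fromSpec]
      exact ⟨Spec.map π y, rfl⟩
    have hxU : x.pt ∈ U := hjU p.pt
    refine ⟨?_, hxU⟩
    by_contra hxS
    obtain ⟨f, hfx, hf⟩ := exists_evalAt_ne_zero_of_notMem hU hS hxU hxS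
    refine hfx ?_
    rw [hx, evalAt_map]
    have hle : ⊤ ≤ j ⁻¹ᵁ U := fun y _ => hjU y
    have h1 := evalAt_res (G := Over.mk (j ≫ G.hom)) hle ((j.app U).hom f) (x := p) trivial
    refine h1.symm.trans ?_
    have h2 : ((Spec (CommRingCat.of (Γ(G.left, U) ⧸ I))).presheaf.map (homOfLE hle).op).hom
        ((j.app U).hom f) = (j.appLE U ⊤ hle).hom f := rfl
    have h3 : (Scheme.ΓSpecIso (CommRingCat.of (Γ(G.left, U) ⧸ I))).hom.hom
        ((j.appLE U ⊤ hle).hom f) = 0 := by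
      have h4 := appLE_fromSpec_ΓSpecIso hU π hle
      have h5 : (Scheme.ΓSpecIso (CommRingCat.of (Γ(G.left, U) ⧸ I))).hom.hom
        ((j.appLE U ⊤ hle).hom f) = π.hom f := congr(($h4).hom f)
      rw [h5]
      exact Ideal.Quotient.eq_zero_iff_mem.2 fun y hy => hf y hy.1
    have h6 : (j.appLE U ⊤ hle).hom f = 0 :=
      (map_eq_zero_iff _ (ConcreteCategory.bijective_of_isIso
        (Scheme.ΓSpecIso (CommRingCat.of (Γ(G.left, U) ⧸ I))).hom).1).1 h3
    exact (congrArg (fun g => evalAt (G := Over.mk (j ≫ G.hom)) (U := ⊤) g p) (h2.trans h6)).trans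
      (evalAt_zero _)

end AffineImages

/-! ### The dimension bound for affine images inside E(ℂ^d). -/

section Dimension

variable {G : Over SpecC}

lemma evalAt_aeval {U : G.left.Opens} {x : Points G} (hx : x.pt ∈ U) {r : ℕ}
    (y : Fin r → Γ(G.left, U)) (p : MvPolynomial (Fin r) ℂ) :
    evalAt (MvPolynomial.aeval y p) x = MvPolynomial.eval (fun i => evalAt (y i) x) p := by
  rw [← evalHom_apply hx, ← AlgHom.comp_apply, MvPolynomial.comp_aeval]
  simp only [evalHom_apply]
  rfl

variable [LocallyOfFiniteType G.hom] [IsSeparated G.hom]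

/-- An irreducible affine image inside a holomorphic image of `ℂ ^ d` has Zariski closure of
dimension at most `d`. -/
lemma length_le_of_subset_range {d : ℕ} {E : (Fin d → ℂ) → Points G}
    (hE : ∀ x, HolomorphicAt E x) {Z : Set (Points G)} (hZaff : IsAffineImage Z)
    (hZE : Z ⊆ Set.range E) {n : ℕ} (C : Fin (n + 1) → Set (Points G))
    (hCclosed : ∀ i, IsClosed (C i)) (hCirr : ∀ i, IsIrreducible (C i)) (hCmono : StrictMono C)
    (hCZ : ∀ i, C i ⊆ closure Z) : n ≤ d := by
  -- An affine neighbourhood of a point of the smallest member `C 0` meets every member of the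
  -- chain.
  obtain ⟨x, hx⟩ := (hCirr 0).1
  obtain ⟨V, hV, hxV⟩ := exists_isAffineOpen_mem x
  have hCV : ∀ i, ∃ x ∈ C i, x.pt ∈ V := fun i => ⟨x, hCmono.monotone (Fin.zero_le i) hx, hxV⟩
  have := finiteType_sections (G := G) ⟨V, hV⟩
  obtain ⟨r, hnr, y, hy⟩ := exists_algebraicIndependent_of_strictAnti (k := ℂ)
    (vanishingIdeal V Z) (fun i => vanishingIdeal V (C i))
    (fun i => vanishingIdeal_isPrime (hCirr i) (hCV i))
    (fun i => (vanishingIdeal_closure V Z).symm.trans_le (vanishingIdeal_anti (hCZ i)))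
    (fun i j hij => vanishingIdeal_lt hV (hCclosed i) (hCirr j) (hCV j) (hCmono hij))
  refine hnr.trans ?_
  obtain ⟨X, β, hX, hXf, rfl⟩ := hZaff
  -- A morphism from an affine scheme to a separated one is affine, so the preimage of V is affine.
  have hβ : IsAffineHom β.left := by
    have h1 : IsAffineHom (β.left ≫ G.hom) := by
      rw [Over.w]
      infer_instance
    exact IsAffineHom.of_comp β.left G.hom
  have hW : IsAffineOpen (β.left ⁻¹ᵁ V) := hV.preimage β.left
  have := finiteType_sections (G := X) ⟨_, hW⟩
  have hb : ∀ p : MvPolynomial (Fin r) ℂ,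
      MvPolynomial.aeval (fun i => (β.left.app V).hom (y i)) p = 0 → p = 0 := by
    refine fun p hp => hy p ?_
    rintro _ ⟨z, rfl⟩
    by_cases hz : z.pt ∈ β.left ⁻¹ᵁ V
    · have h1 := evalAt_aeval hz (fun i => (β.left.app V).hom (y i)) p
      rw [hp, evalAt_zero] at h1
      rw [evalAt_aeval (by exact hz)]
      simp only [evalAt_map]
      exact h1.symm
    -- Outside V the value is 0 by convention.
    · exact evalAt_of_notMem _ hz
  obtain ⟨q, hq, hsurj⟩ := exists_mvPolynomial_forall_exists_algHom (k := ℂ) _ hb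
  refine le_of_analyticAt_of_subset_image (fun t i => evalAt (y i) (E t))
    {t | (E t).pt ∈ V} (fun t ht => analyticAt_pi_iff.2 fun i => (hE t V ht).2 (y i)) q hq ?_
  intro c hc
  obtain ⟨χ, hχ⟩ := hsurj c hc
  have hp := pointOfAlgHom_pt_mem hW χ
  obtain ⟨t, ht⟩ := hZE ⟨pointOfAlgHom hW χ, rfl⟩
  refine ⟨t, ?_, funext fun i => ?_⟩
  · change (E t).pt ∈ V
    rw [ht]
    exact hp
  · change evalAt (y i) (E t) = c i
    rw [ht, evalAt_map, evalAt_pointOfAlgHom, hχ]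

end Dimension

/-! ### The subgroup generated by S. -/

section Group

variable {G : Over SpecC} [GrpObj G] [IsCommMonObj G]

attribute [local instance] Points.commGroup

instance : SeparatelyContinuousMul (Points G) where
  continuous_const_mul {a} := by
    have := Points.continuous_map (leftTranslation a)
    simpa only [funext (Points.map_leftTranslation a)] using this
  continuous_mul_const {a} := by
    have := Points.continuous_map (leftTranslation a)
    simp only [mul_comm _ a]
    simpa only [funext (Points.map_leftTranslation a)] using this

instance : ContinuousInv (Points G) where
  continuous_inv := Points.continuous_map (ι : G ⟶ G)

variable [LocallyOfFiniteType G.hom] [IsSeparated G.hom]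

/-- An irreducible closed set containing the identity which lies in the image of a holomorphic
homomorphism from `ℂ ^ d` generates a subgroup of dimension at most `d`. -/
lemma topologicalKrullDim_algSpan_le {S : Set (Points G)} (hS_closed : IsClosed S)
    (hS_irred : IsIrreducible S) (hS_one : 1 ∈ S) {d : ℕ} {E : (Fin d → ℂ) → Points G}
    (hE : ∀ x, HolomorphicAt E x) (hEadd : ∀ x y, E (x + y) = E x * E y)
    (hSE : S ⊆ Set.range E) : topologicalKrullDim (algSpan S) ≤ d := by
  obtain ⟨V, hV, h1V⟩ := exists_isAffineOpen_mem (1 : Points G)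
  -- S need not be affine; S₀ is affine, and dense in S by irreducibility.
  let S₀ : Set (Points G) := S ∩ {x | x.pt ∈ V}
  have h1S₀ : (1 : Points G) ∈ S₀ := ⟨hS_one, h1V⟩
  have hVo := Points.isOpen_setOf_pt_mem V
  have hS₀irr : IsIrreducible S₀ := isIrreducible_inter_of_isOpen hS_irred hVo ⟨1, h1S₀⟩
  have hS₀aff : IsAffineImage S₀ := isAffineImage_inter hS_closed hV
  let T : Set (Points G) := S₀ * S₀⁻¹
  have hS₀T : S₀ ⊆ T := fun x hx => ⟨x, hx, 1, by simpa using h1S₀, _root_.mul_one x⟩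
  have h1T : (1 : Points G) ∈ T := hS₀T h1S₀
  have hTirr : IsIrreducible T := by
    refine hS₀irr.mul ?_
    rw [← Set.image_inv_eq_inv]
    exact hS₀irr.image _ continuous_inv.continuousOn
  have hTaff : IsAffineImage T := hS₀aff.mul hS₀aff.inv
  have hTinv : T⁻¹ = T := by simp [T]
  let R : Subgroup (Points G) :=
    (MonoidHom.mk' (fun x : Multiplicative (Fin d → ℂ) => E x.toAdd) fun _ _ => hEadd _ _).range
  have hRE : (R : Set (Points G)) = Set.range E := rfl
  have hTR : T ⊆ R := by
    rintro _ ⟨a, ha, b, hb, rfl⟩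
    refine R.mul_mem (hSE ha.1) ?_
    have := R.inv_mem (show b⁻¹ ∈ R from hSE (Set.mem_inv.1 hb).1)
    rwa [inv_inv] at this
  have hpow : ∀ m, T ^ m ⊆ Set.range E := by
    intro m
    induction m with
    | zero => simpa using ((hRE ▸ R.one_mem : (1 : Points G) ∈ Set.range E))
    | succ m ih =>
      rw [_root_.pow_succ]
      rintro _ ⟨a, ha, b, hb, rfl⟩
      exact R.mul_mem (ih ha) (hTR hb)
  have hmono : Monotone fun m : ℕ => closure (T ^ m) :=
    fun m n hmn => closure_mono (Set.pow_subset_pow_right h1T hmn)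
  obtain ⟨m, hm⟩ : ∃ m, closure (T ^ (m + 1)) = closure (T ^ (m + 1 + 1)) := by
    by_contra! hne
    have hstrict : StrictMono fun m : ℕ => closure (T ^ (m + 1)) :=
      strictMono_nat_of_lt_succ fun m => lt_of_le_of_ne (hmono (Nat.le_succ _)) (hne m)
    -- The closures of T, …, T^(d+2) would form a chain of length d + 1, exceeding the bound d.
    have := length_le_of_subset_range hE (hTaff.pow_succ (d + 1)) (hpow _)
      (fun i : Fin (d + 1 + 1) => closure (T ^ (i.1 + 1))) (fun _ => isClosed_closure)
      (fun i => (IsIrreducible.pow_succ hTirr i.1).closure) (fun i j hij => hstrict hij)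
      (fun i => hmono (by have := i.2; omega))
    omega
  obtain ⟨K, hK⟩ := exists_subgroup_eq_closure_pow h1T hTinv (m + 1) hm
  have hspan : algSpan S ≤ K := by
    refine (isLeast_algSpan S).2 ⟨hK ▸ isClosed_closure, ?_⟩
    rw [hK]
    refine (subset_closure_inter_of_isIrreducible hS_irred hVo ⟨1, h1S₀⟩).trans
      (closure_mono (hS₀T.trans ?_))
    simpa using Set.pow_subset_pow_right h1T (Nat.le_add_left 1 m)
  have hclosed : IsClosed (algSpan S : Set (Points G)) := (isLeast_algSpan S).1.1
  refine iSup_le fun c => ?_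
  -- Since ⟨S⟩ is closed in G(ℂ), a chain of irreducible closed subsets of it remains one in G(ℂ),
  -- inside the closure of T^(m+1).
  have hlen : c.length ≤ d := by
    refine length_le_of_subset_range hE (hTaff.pow_succ m) (hpow _)
      (fun i => Subtype.val '' (c i : Set (algSpan S)))
      (fun i => hclosed.isClosedEmbedding_subtypeVal.isClosedMap _ (c i).isClosed)
      (fun i => (c i).isIrreducible.image _ continuous_subtype_val.continuousOn)
      (fun i j hij => ?_) (fun i => ?_)
    · exact Set.monotone_image.strictMono_of_injective Subtype.val_injective.image_injective
        (show (c i : Set (algSpan S)) < c j from c.strictMono hij)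
    · rw [← hK]
      rintro _ ⟨x, -, rfl⟩
      exact hspan x.2
  exact_mod_cast hlen

end Group

end AlgGrp

end

theorem corollary2p3 (G : Over AlgGrp.SpecC) [GrpObj G] [IsCommMonObj G]
    [LocallyOfFiniteType G.hom] [QuasiCompact G.hom] [IsSeparated G.hom]
    [IsReduced G.left] [ConnectedSpace G.left]
    (S : Set (AlgGrp.Points G)) (hS_closed : IsClosed S) (hS_irred : IsIrreducible S)
    (hS_one : (1 : AlgGrp.Points G) ∈ S)
    (h : LieSubalgebra ℂ (AlgGrp.lieAlg G))
    (hS : S ⊆ AlgGrp.exp '' (h : Set (AlgGrp.lieAlg G))) :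
    topologicalKrullDim (AlgGrp.algSpan S) ≤ ((Module.finrank ℂ h : ℕ) : WithBot ℕ∞) := by
  obtain ⟨d, hd, E, hE, hEadd, hexp⟩ := AlgGrp.exists_holomorphic_hom h
  exact (AlgGrp.topologicalKrullDim_algSpan_le hS_closed hS_irred hS_one hE hEadd
    (hS.trans hexp)).trans (by exact_mod_cast hd)
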